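/- Let $(M,g)$ be a smooth four-dimensional Riemannian manifold (not necessarily complete) with harmonic curvature, i.e. the divergence of its curvature tensor vanishes. Let $Rc$ and $R$ denote the Ricci tensor and the scalar curvature of $g$. Let $x\in\mathbb{R}$, let $y:\mathbb{R}\to\mathbb{R}$ be a function, and suppose that a non-constant smooth function $f$ on $M$ satisfies $$\nabla df = f\Big(Rc-\frac{R}{3}\,g\Big)+x\,Rc+y(R)\,g .$$ Let $M_r$ be the set of points of $M$ in a neighbourhood of which the number of distinct eigenvalues of $Rc$ is constant. Let $U$ be an open subset of $M_r\cap\{\nabla f\neq 0\}$ and let $E_1,E_2,E_3,E_4$ be an adapted frame field on $U$, that is, a smooth orthonormal frame with $Rc(E_i,\cdot)=\lambda_i\, g(E_i,\cdot)$ for $i=1,\dots,4$, with $E_1=\nabla f/|\nabla f|$ and with $E_2,E_3,E_4$ tangent to the level hypersurfaces of $f$. Then the three eigenfunctions $\lambda_2,\lambda_3,\lambda_4$ cannot be pairwise distinct: at every point of $U$ at least two of the three values coincide, and if $U$ is connected, then two of the three functions coincide on all of $U$. -/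

import Mathlib

open Bundle
open scoped Manifold ContDiff Topology

/-! Riemannian geometry on an `n`-dimensional manifold `M`: the tangent bundle carries a smooth
Riemannian metric, whose value on `u v : T_p M` is `inner ℝ u v`. -/

noncomputable section

namespace RiemGeom

section

variable {n : ℕ} {M : Type*} [TopologicalSpace M] [ChartedSpace (EuclideanSpace ℝ (Fin n)) M]

/-- A (not necessarily continuous) vector field on `M`. -/
abbrev Field (n : ℕ) (M : Type*) [TopologicalSpace M]
    [ChartedSpace (EuclideanSpace ℝ (Fin n)) M] : Type _ :=
  Π p : M, TangentSpace (𝓡 n) p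

/-- The vector field `X` is smooth on the set `U`. -/
def SmoothFieldOn [IsManifold (𝓡 n) 1 M] (X : Field n M) (U : Set M) : Prop :=
  ContMDiffOn (𝓡 n) (𝓡 n).tangent ∞ (fun p => (⟨p, X p⟩ : TangentBundle (𝓡 n) M)) U

/-- `df_p(v)`, the derivative of the function `f` at `p` in the direction `v`. -/
def dirDeriv (f : M → ℝ) (p : M) (v : TangentSpace (𝓡 n) p) : ℝ :=
  mvfderiv (𝓡 n) f p v

variable [IsManifold (𝓡 n) ∞ M]

/-- A vector field, smooth near `p`, with the value `v` at `p`. -/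
def ext {p : M} (v : TangentSpace (𝓡 n) p) : Field n M :=
  FiberBundle.extend (EuclideanSpace ℝ (Fin n)) v

variable [RiemannianBundle (fun p : M => TangentSpace (𝓡 n) p)]

instance (p : M) : FiniteDimensional ℝ (TangentSpace (𝓡 n) p) :=
  inferInstanceAs (FiniteDimensional ℝ (EuclideanSpace ℝ (Fin n)))

/-- An orthonormal basis of `T_p M`, used only to take traces and to identify `T_p M` with its
dual. -/
def onb (p : M) :
    OrthonormalBasis (Fin (Module.finrank ℝ (TangentSpace (𝓡 n) p))) ℝ (TangentSpace (𝓡 n) p) :=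
  stdOrthonormalBasis ℝ (TangentSpace (𝓡 n) p)

/-- The right-hand side of the Koszul formula: this is `g(∇_X Y, Z)` for the Levi-Civita
connection `∇`. -/
def koszul (X Y Z : Field n M) (p : M) : ℝ :=
  (dirDeriv (fun q => inner ℝ (Y q) (Z q)) p (X p)
    + dirDeriv (fun q => inner ℝ (Z q) (X q)) p (Y p)
    - dirDeriv (fun q => inner ℝ (X q) (Y q)) p (Z p)
    + inner ℝ (VectorField.mlieBracket (𝓡 n) X Y p) (Z p)
    - inner ℝ (VectorField.mlieBracket (𝓡 n) X Z p) (Y p)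
    - inner ℝ (VectorField.mlieBracket (𝓡 n) Y Z p) (X p)) / 2

/-- The Levi-Civita connection: `cov Y p v` is `∇_v Y`, for `v : T_p M` and a vector field `Y`. -/
def cov (Y : Field n M) (p : M) (v : TangentSpace (𝓡 n) p) : TangentSpace (𝓡 n) p :=
  ∑ i, koszul (ext v) Y (ext (onb p i)) p • onb p i

/-- The vector field `∇_X Y`. -/
def nabla (X Y : Field n M) : Field n M := fun p => cov Y p (X p)

/-- The curvature tensor
`R(X, Y) Z = ∇_X ∇_Y Z - ∇_Y ∇_X Z - ∇_{[X, Y]} Z` on vector fields. -/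
def curv (X Y Z : Field n M) : Field n M :=
  nabla X (nabla Y Z) - nabla Y (nabla X Z) - nabla (VectorField.mlieBracket (𝓡 n) X Y) Z

/-- The covariant derivative `(∇_W R)(X, Y) Z` of the curvature tensor. -/
def covCurv (W X Y Z : Field n M) : Field n M :=
  nabla W (curv X Y Z) - curv (nabla W X) Y Z - curv X (nabla W Y) Z - curv X Y (nabla W Z)

/-- The Ricci tensor `Rc(v, w) = tr (u ↦ R(u, v) w)` at `p`. -/
def ricci (p : M) (v w : TangentSpace (𝓡 n) p) : ℝ :=
  ∑ i, inner ℝ (curv (ext (onb p i)) (ext v) (ext w) p) (onb p i)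

variable (n) in
/-- The scalar curvature. -/
def scal (p : M) : ℝ := ∑ i, ricci (n := n) p (onb p i) (onb p i)

/-- `W 0, …, W (n - 1)` is a smooth orthonormal frame on the set `U`. -/
structure IsOrthonormalFrameOn (W : Fin n → Field n M) (U : Set M) : Prop where
  smooth : ∀ i, SmoothFieldOn (W i) U
  orthonormal : ∀ p ∈ U, Orthonormal ℝ (fun i => W i p)

variable (n M) in
/-- `M` has harmonic curvature: the divergence of the curvature tensor vanishes, that is,
`∑ i, g((∇_{W i} R)(X, Y) Z, W i) = 0` for all local vector fields `X, Y, Z` and every local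
orthonormal frame `W`. -/
def HasHarmonicCurvature : Prop :=
  ∀ (V : Set M), IsOpen V → ∀ W : Fin n → Field n M, IsOrthonormalFrameOn W V →
    ∀ X Y Z : Field n M, SmoothFieldOn X V → SmoothFieldOn Y V → SmoothFieldOn Z V →
      ∀ p ∈ V, ∑ i, inner ℝ (covCurv (W i) X Y Z p) (W i p) = 0

variable (n) in
/-- The gradient of `f`. -/
def grad (f : M → ℝ) : Field n M := fun p => ∑ i, dirDeriv f p (onb p i) • onb p i

/-- The Hessian `(∇df)(v, w) = g(∇_v ∇f, w)` at `p`. -/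
def hess (f : M → ℝ) (p : M) (v w : TangentSpace (𝓡 n) p) : ℝ :=
  inner ℝ (cov (grad n f) p v) w

variable (n) in
/-- The number of distinct eigenvalues of the Ricci tensor at `p`. -/
def ricciEigenvalueCount (p : M) : ℕ :=
  Set.ncard {l : ℝ | ∃ v : TangentSpace (𝓡 n) p, v ≠ 0 ∧
    ∀ w : TangentSpace (𝓡 n) p, ricci p v w = l * inner ℝ v w}

variable (n M) in
/-- The set `M_r` of the points near which the number of distinct Ricci eigenvalues is constant. -/
def ricciRegularSet : Set M :=
  {p : M | ∀ᶠ q in 𝓝 p, ricciEigenvalueCount n q = ricciEigenvalueCount n p}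

/-- `E` is an adapted frame field for `f` on `U` with Ricci eigenfunctions `lam`: a smooth
orthonormal frame of Ricci eigenvector fields, whose first member is `∇f / |∇f|` and whose other
members are tangent to the level hypersurfaces of `f`. The index `0` stands for the first member. -/
structure IsAdaptedFrameOn [NeZero n] (f : M → ℝ) (E : Fin n → Field n M) (lam : Fin n → M → ℝ)
    (U : Set M) : Prop extends IsOrthonormalFrameOn E U where
  eigen : ∀ p ∈ U, ∀ i, ∀ w : TangentSpace (𝓡 n) p,
    ricci p (E i p) w = lam i p * inner ℝ (E i p) w
  first : ∀ p ∈ U, E 0 p = ‖grad n f p‖⁻¹ • grad n f p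
  tangent : ∀ p ∈ U, ∀ i, i ≠ 0 → dirDeriv f p (E i p) = 0

end

end RiemGeom

end

set_option linter.unusedSectionVars false

/-! Suppose that the three eigenvalues tangent to the level sets are distinct at a point; index 0 is
the direction of ∇f, indices 1, 2, 3 are the others. By the second Bianchi identity, harmonic
curvature makes Rc a Codazzi tensor and R locally constant. With φ = f + x and h = y(R) - Rf/3 the
equation becomes ∇df = φ Rc + h g, with dh = -(R/3) dφ.

Put N = |∇f|, c = φ/N, d = h/N. The level sets have principal curvatures ζ_j = c λ_j + d, and
Codazzi gives E_0 λ_j = (λ_0 - λ_j) ζ_j. These evolution equations force the power sums of λ_1, λ_2,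
λ_3 to be constant on level sets, hence each λ_j is, by a Vandermonde argument. The only connection
coefficients left inside a level set are A = Γ_123, B = Γ_231, C = Γ_312, with (λ_2 - λ_3)A = (λ_3 -
λ_1)B = (λ_1 - λ_2)C. The Ricci equations express the intrinsic sectional curvatures of the level
sets through A, B, C; eliminating these leaves two algebraic relations among the λ_j, c and d
(`IsLie.not_distinct`).

Differentiating these relations repeatedly along E_0 yields cE = -4, where E = ζ_1 + ζ_2 + ζ_3, and
then a vanishing discriminant for the cubic whose roots are the trace-free parts of the λ_j,
contradicting distinctness (`not_distinct_of_ode`).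

All of this is algebra in the ring of germs of smooth functions at the point: identities of germs
may be differentiated, and a germ with nonzero value is a unit. `IsFrameNear.calc` and the `coef`
lemmas translate the geometry into this algebra. On a connected set the pattern of coincidences is
constant because the number of Ricci eigenvalues is locally constant on M_r
(`IsAdaptedFrameOn.eq_iff`). -/

namespace RiemGeom

/-! Frame calculus over a commutative ring: derivations `D i` and connection coefficients `Γ`. -/

/-- A commutative ring `S` of functions with the derivations `D i` given by the members of an
orthonormal frame and the coefficients `Γ i j k = g(∇_{E i} E j, E k)` of a metric connection. -/
structure FrameCalculus (ι S : Type*) [CommRing S] [Algebra ℝ S] where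
  D : ι → Derivation ℝ S S
  Γ : ι → ι → ι → S
  skew : ∀ i j k, Γ i j k = -Γ i k j

namespace FrameCalculus

variable {ι S : Type*} [Fintype ι] [DecidableEq ι] [CommRing S] [Algebra ℝ S]
  (F : FrameCalculus ι S)

/-- The derivative of a function along the field with coefficients `a`. -/
def act (a : ι → S) (s : S) : S := ∑ i, a i * F.D i s

/-- The covariant derivative `∇_a b`. -/
def nab (a b : ι → S) : ι → S := fun k => F.act a (b k) + ∑ i, ∑ j, a i * b j * F.Γ i j k

/-- The Lie bracket, for a torsion-free connection. -/
def br (a b : ι → S) : ι → S := F.nab a b - F.nab b a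

/-- The curvature tensor. -/
def Rm (a b c : ι → S) : ι → S := F.nab a (F.nab b c) - F.nab b (F.nab a c) - F.nab (F.br a b) c

/-- The covariant derivative of the curvature tensor. -/
def covRm (w a b c : ι → S) : ι → S :=
  F.nab w (F.Rm a b c) - F.Rm (F.nab w a) b c - F.Rm a (F.nab w b) c - F.Rm a b (F.nab w c)

/-- The frame fields. -/
def e (i : ι) : ι → S := Pi.single i 1

/-- The Ricci tensor. -/
def Ric (b c : ι → S) : S := ∑ i, F.Rm (e i) b c i

/-- The covariant derivative of the Ricci tensor. -/
def covRic (w b c : ι → S) : S :=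
  F.act w (F.Ric b c) - F.Ric (F.nab w b) c - F.Ric b (F.nab w c)

/-- The bracket is a Lie bracket which acts on functions through commutators. -/
structure IsLie : Prop where
  comm : ∀ a b s, F.act a (F.act b s) - F.act b (F.act a s) = F.act (F.br a b) s
  jacobi : ∀ a b c, F.br a (F.br b c) = F.br (F.br a b) c + F.br b (F.br a c)

@[simp] lemma act_add (a : ι → S) (s t : S) : F.act a (s + t) = F.act a s + F.act a t := by
  simp [act, mul_add, Finset.sum_add_distrib]

@[simp] lemma act_zero (a : ι → S) : F.act a 0 = 0 := by simp [act]

@[simp] lemma act_one (a : ι → S) : F.act a 1 = 0 := by simp [act]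

lemma act_mul (a : ι → S) (s t : S) : F.act a (s * t) = s * F.act a t + t * F.act a s := by
  simp only [act, Derivation.leibniz, smul_eq_mul, Finset.mul_sum, ← Finset.sum_add_distrib]
  exact Finset.sum_congr rfl fun i _ => by ring

lemma act_sum {κ : Type*} (t : Finset κ) (a : ι → S) (s : κ → S) :
    F.act a (∑ k ∈ t, s k) = ∑ k ∈ t, F.act a (s k) := by
  simp only [act, map_sum, Finset.mul_sum]
  exact Finset.sum_comm

@[simp] lemma add_act (a b : ι → S) (s : S) : F.act (a + b) s = F.act a s + F.act b s := by
  simp [act, add_mul, Finset.sum_add_distrib]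

@[simp] lemma smul_act (r : S) (a : ι → S) (s : S) : F.act (r • a) s = r * F.act a s := by
  simp [act, mul_assoc, Finset.mul_sum]

@[simp] lemma e_act (i : ι) (s : S) : F.act (e i) s = F.D i s := by
  simp [act, e, Pi.single_apply]

@[simp] lemma nab_add (a b c : ι → S) : F.nab a (b + c) = F.nab a b + F.nab a c := by
  ext k
  simp only [nab, Pi.add_apply, act_add, mul_add, add_mul, Finset.sum_add_distrib]
  ring

@[simp] lemma add_nab (a b c : ι → S) : F.nab (a + b) c = F.nab a c + F.nab b c := by
  ext k
  simp only [nab, Pi.add_apply, add_act, add_mul, Finset.sum_add_distrib]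
  ring

@[simp] lemma smul_nab (r : S) (a b : ι → S) : F.nab (r • a) b = r • F.nab a b := by
  ext k
  simp only [nab, Pi.smul_apply, smul_act, smul_eq_mul, mul_add, Finset.mul_sum, mul_assoc]

lemma nab_smul (a : ι → S) (r : S) (b : ι → S) :
    F.nab a (r • b) = r • F.nab a b + F.act a r • b := by
  ext k
  have : ∑ i, ∑ j, a i * (r * b j) * F.Γ i j k = r * ∑ i, ∑ j, a i * b j * F.Γ i j k := by
    simp only [Finset.mul_sum]
    exact Finset.sum_congr rfl fun i _ => Finset.sum_congr rfl fun j _ => by ring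
  simp only [nab, Pi.smul_apply, Pi.add_apply, smul_eq_mul, act_mul, this]
  ring

/-- `∇` as an additive map in both arguments. -/
def nabHom : (ι → S) →+ (ι → S) →+ (ι → S) :=
  AddMonoidHom.mk' (fun a => AddMonoidHom.mk' (F.nab a) (F.nab_add a))
    fun a b => AddMonoidHom.ext fun c => F.add_nab a b c

lemma nab_sub (a b c : ι → S) : F.nab a (b - c) = F.nab a b - F.nab a c :=
  map_sub (F.nabHom a) b c

lemma sub_nab (a b c : ι → S) : F.nab (a - b) c = F.nab a c - F.nab b c :=
  DFunLike.congr_fun (map_sub F.nabHom a b) c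

lemma nab_e (i j k : ι) : F.nab (e i) (e j) k = F.Γ i j k := by
  have h : F.D i ((e j : ι → S) k) = 0 := by
    by_cases hjk : k = j <;> simp [e, hjk]
  simp only [nab, e_act, h, zero_add]
  simp [e, Pi.single_apply]

lemma metric (w a b : ι → S) : F.act w (a ⬝ᵥ b) = F.nab w a ⬝ᵥ b + a ⬝ᵥ F.nab w b := by
  have h : ∑ k, ∑ i, ∑ j, (w i * a j * F.Γ i j k * b k + w i * b j * F.Γ i j k * a k) = 0 := by
    rw [Finset.sum_comm]
    refine Finset.sum_eq_zero fun i _ => ?_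
    simp only [Finset.sum_add_distrib]
    rw [Finset.sum_comm, ← Finset.sum_add_distrib]
    refine Finset.sum_eq_zero fun j _ => ?_
    rw [← Finset.sum_add_distrib]
    refine Finset.sum_eq_zero fun k _ => ?_
    rw [F.skew i j k]; ring
  simp only [Finset.sum_add_distrib] at h
  simp only [dotProduct, act_sum, act_mul, nab, add_mul, mul_add, Finset.sum_add_distrib,
    Finset.sum_mul, Finset.mul_sum]
  have h1 : ∑ k, ∑ i, ∑ j, a k * (w i * b j * F.Γ i j k)
      = ∑ k, ∑ i, ∑ j, w i * b j * F.Γ i j k * a k :=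
    Finset.sum_congr rfl fun k _ => Finset.sum_congr rfl fun i _ => Finset.sum_congr rfl
      fun j _ => by ring
  have h2 : ∑ k, b k * F.act w (a k) = ∑ k, F.act w (a k) * b k :=
    Finset.sum_congr rfl fun k _ => mul_comm _ _
  rw [h1, h2]
  linear_combination -h

lemma act_br_e (i j : ι) : F.br (e i) (e j) = fun k => F.Γ i j k - F.Γ j i k := by
  ext k; simp [br, nab_e]

lemma br_swap (a b : ι → S) : F.br a b = -F.br b a := by simp [br]

lemma Rm_swap (a b c : ι → S) : F.Rm a b c = -F.Rm b a c := by
  have h : F.nab (F.br b a) c = -F.nab (F.br a b) c := by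
    rw [br_swap, ← zero_sub, sub_nab, ← sub_self a, sub_nab, sub_self, zero_sub]
  simp only [Rm, h]; abel

variable {F}

/-- Metric compatibility turns the commutator identity applied to the function g(c, d) into this
skewness. -/
lemma IsLie.Rm_skew (hF : F.IsLie) (a b c d : ι → S) :
    F.Rm a b c ⬝ᵥ d = -(c ⬝ᵥ F.Rm a b d) := by
  have h := hF.comm a b (c ⬝ᵥ d)
  simp only [metric, act_add] at h
  simp only [Rm, sub_dotProduct, dotProduct_sub]
  linear_combination h

/-- With brackets written as differences of covariant derivatives, the cyclic sum cancels except for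
∇ of the Jacobi expression applied to c. -/
lemma IsLie.bianchi (hF : F.IsLie) (w a b c : ι → S) :
    F.covRm w a b c + F.covRm a b w c + F.covRm b w a c = 0 := by
  have j : F.nab (F.br w (F.br a b)) c = F.nab (F.br (F.br w a) b) c
      + F.nab (F.br a (F.br w b)) c := by rw [hF.jacobi, add_nab]
  simp only [br, nab_sub, sub_nab] at j
  simp only [covRm, Rm, br, nab_sub, sub_nab]
  rw [← sub_eq_zero] at j
  rw [← neg_eq_zero, ← j]
  abel

/-! ### Tensoriality -/

variable (F) in
lemma Rm_add_left (a a' b c : ι → S) : F.Rm (a + a') b c = F.Rm a b c + F.Rm a' b c := by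
  simp only [Rm, br, sub_nab, nab_add, add_nab]; abel

variable (F) in
lemma Rm_add_mid (a b b' c : ι → S) : F.Rm a (b + b') c = F.Rm a b c + F.Rm a b' c := by
  simp only [Rm, br, sub_nab, nab_add, add_nab]; abel

variable (F) in
lemma Rm_add_right (a b c c' : ι → S) : F.Rm a b (c + c') = F.Rm a b c + F.Rm a b c' := by
  simp only [Rm, nab_add]; abel

variable (F) in
lemma Rm_smul_left (r : S) (a b c : ι → S) : F.Rm (r • a) b c = r • F.Rm a b c := by
  simp only [Rm, br, sub_nab, nab_smul, smul_nab, add_nab]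
  module

variable (F) in
lemma Rm_smul_mid (r : S) (a b c : ι → S) : F.Rm a (r • b) c = r • F.Rm a b c := by
  rw [Rm_swap, Rm_smul_left, Rm_swap F a b, smul_neg]

/-- The third slot is the only one whose linearity needs the bracket to act on functions as a
commutator. -/
lemma IsLie.Rm_smul_right (hF : F.IsLie) (r : S) (a b c : ι → S) :
    F.Rm a b (r • c) = r • F.Rm a b c := by
  have h := hF.comm a b r
  simp only [Rm, nab_smul, nab_add, ← h]
  module

lemma eq_sum_e (a : ι → S) : a = ∑ i, a i • e i := by
  ext k; simp [e, Pi.single_apply]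

lemma IsLie.Rm_apply (hF : F.IsLie) (a b c : ι → S) (l : ι) :
    F.Rm a b c l = ∑ i, ∑ j, ∑ k, a i * b j * c k * F.Rm (e i) (e j) (e k) l := by
  let L1 : ∀ b c : ι → S, (ι → S) →ₗ[S] (ι → S) := fun b c =>
    { toFun := fun a => F.Rm a b c, map_add' := fun _ _ => F.Rm_add_left _ _ _ _,
      map_smul' := fun _ _ => F.Rm_smul_left _ _ _ _ }
  let L2 : ∀ a c : ι → S, (ι → S) →ₗ[S] (ι → S) := fun a c =>
    { toFun := fun b => F.Rm a b c, map_add' := fun _ _ => F.Rm_add_mid _ _ _ _,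
      map_smul' := fun _ _ => F.Rm_smul_mid _ _ _ _ }
  let L3 : ∀ a b : ι → S, (ι → S) →ₗ[S] (ι → S) := fun a b =>
    { toFun := fun c => F.Rm a b c, map_add' := fun _ _ => F.Rm_add_right _ _ _ _,
      map_smul' := fun _ _ => hF.Rm_smul_right _ _ _ _ }
  have h1 : F.Rm a b c = ∑ i, a i • F.Rm (e i) b c := by
    conv_lhs => rw [eq_sum_e a]
    exact (map_sum (L1 b c) _ _).trans (Finset.sum_congr rfl fun i _ => map_smul (L1 b c) _ _)
  have h2 : ∀ i, F.Rm (e i) b c = ∑ j, b j • F.Rm (e i) (e j) c := fun i => by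
    conv_lhs => rw [eq_sum_e b]
    exact (map_sum (L2 _ c) _ _).trans (Finset.sum_congr rfl fun i _ => map_smul (L2 _ c) _ _)
  have h3 : ∀ i j, F.Rm (e i) (e j) c = ∑ k, c k • F.Rm (e i) (e j) (e k) := fun i j => by
    conv_lhs => rw [eq_sum_e c]
    exact (map_sum (L3 _ _) _ _).trans (Finset.sum_congr rfl fun i _ => map_smul (L3 _ _) _ _)
  simp only [h1, h2, h3, Finset.sum_apply, Pi.smul_apply, smul_eq_mul, Finset.mul_sum, mul_assoc]

lemma IsLie.Ric_apply (hF : F.IsLie) (b c : ι → S) :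
    F.Ric b c = ∑ j, ∑ k, b j * c k * F.Ric (e j) (e k) := by
  simp only [Ric, hF.Rm_apply _ b c, Finset.mul_sum]
  have : ∀ i : ι, (∑ a, ∑ j, ∑ k, (e i : ι → S) a * b j * c k * F.Rm (e a) (e j) (e k) i)
      = ∑ j, ∑ k, b j * c k * F.Rm (e i) (e j) (e k) i := fun i => by
    simp [e, Pi.single_apply]
  simp only [this]
  rw [Finset.sum_comm]
  exact Finset.sum_congr rfl fun j _ => Finset.sum_comm

/-! ### Contracted Bianchi identities -/

@[simp] lemma dotProduct_e (a : ι → S) (i : ι) : a ⬝ᵥ e i = a i := by simp [e]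

variable (F) in
-- The matrix of ∇_w in an orthonormal frame is skew, so the two contractions with it cancel. This
-- is what lets the trace commute with ∇.
lemma sum_Rm_skew_left (w b c : ι → S) :
    ∑ i, (F.Rm (F.nab w (e i)) b c i + F.Rm (e i) b c ⬝ᵥ F.nab w (e i)) = 0 := by
  have hs : ∀ i k, F.nab w (e i) k = -F.nab w (e k) i := fun i k => by
    have h := F.metric w (e i) (e k)
    rw [dotProduct_comm (e i) (F.nab w (e k))] at h
    simp only [dotProduct_e] at h
    have h0 : F.act w ((e i : ι → S) k) = 0 := by
      by_cases hik : k = i <;> simp [e, hik]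
    rw [h0] at h
    linear_combination -h
  let L1 : (ι → S) →ₗ[S] (ι → S) :=
    { toFun := fun a => F.Rm a b c, map_add' := fun _ _ => F.Rm_add_left _ _ _ _,
      map_smul' := fun _ _ => F.Rm_smul_left _ _ _ _ }
  have h1 : ∀ a, F.Rm a b c = ∑ i, a i • F.Rm (e i) b c := fun a => by
    conv_lhs => rw [eq_sum_e a]
    exact (map_sum L1 _ _).trans (Finset.sum_congr rfl fun i _ => map_smul L1 _ _)
  rw [Finset.sum_add_distrib]
  simp only [h1 (F.nab w _), Finset.sum_apply, Pi.smul_apply, smul_eq_mul, dotProduct]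
  rw [Finset.sum_comm, ← Finset.sum_add_distrib]
  refine Finset.sum_eq_zero fun i _ => ?_
  rw [← Finset.sum_add_distrib]
  refine Finset.sum_eq_zero fun k _ => ?_
  rw [hs k i]; ring

variable (F) in
lemma sum_covRm (w b c : ι → S) : ∑ i, F.covRm w (e i) b c i = F.covRic w b c := by
  have h := F.sum_Rm_skew_left w b c
  have hm : ∀ i, F.nab w (F.Rm (e i) b c) i
      = F.act w (F.Rm (e i) b c i) - F.Rm (e i) b c ⬝ᵥ F.nab w (e i) := fun i => by
    have := F.metric w (F.Rm (e i) b c) (e i)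
    simp only [dotProduct_e] at this
    linear_combination -this
  simp only [covRm, Pi.sub_apply, hm, Finset.sum_sub_distrib, covRic, Ric, act_sum]
  rw [Finset.sum_add_distrib] at h
  linear_combination -h

variable (F) in
lemma covRm_swap (w a b c : ι → S) : F.covRm w a b c = -F.covRm w b a c := by
  have h : F.nab w (-F.Rm b a c) = -F.nab w (F.Rm b a c) := map_neg (F.nabHom w) _
  simp only [covRm]
  rw [F.Rm_swap a b, F.Rm_swap (F.nab w a), F.Rm_swap a (F.nab w b), F.Rm_swap a b (F.nab w c), h]
  abel

/-- The second Bianchi identity is traced over its first slot: one term is the divergence, the other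
two are covariant derivatives of Ricci. -/
lemma IsLie.codazzi (hF : F.IsLie) (a b c : ι → S) (hdiv : ∑ i, F.covRm (e i) a b c i = 0) :
    F.covRic a b c = F.covRic b a c := by
  have h : ∑ i, (F.covRm (e i) a b c + F.covRm a b (e i) c + F.covRm b (e i) a c) i = 0 :=
    Finset.sum_eq_zero fun i _ => by rw [hF.bianchi]; rfl
  simp only [F.covRm_swap a b, Pi.add_apply, Pi.neg_apply, Finset.sum_add_distrib,
    Finset.sum_neg_distrib, sum_covRm, hdiv] at h
  linear_combination -h

/-- If the Ricci tensor is diagonal in the frame, the divergence of the curvature tensor computes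
the divergence of the Ricci tensor. -/
lemma IsLie.div_ric (hF : F.IsLie) (lam : ι → S)
    (hlam : ∀ i j, F.Ric (e i) (e j) = if i = j then lam i else 0) (k : ι)
    (hdiv : ∀ j, ∑ i, F.covRm (e i) (e k) (e j) (e j) i = 0) :
    F.D k (lam k) + ∑ i, (lam k - lam i) * F.Γ i k i = 0 := by
  -- Tracing the two middle slots gives the Ricci operator, by both skew symmetries of the
  -- curvature.
  have hQ : ∀ (a : ι → S) (i : ι), ∑ j, F.Rm a (e j) (e j) i = a i * lam i := fun a i => by
    have : ∀ j, F.Rm a (e j) (e j) i = F.Rm (e j) a (e i) j := fun j => by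
      have h := hF.Rm_skew a (e j) (e j) (e i)
      rw [dotProduct_comm (e j)] at h
      simp only [dotProduct_e] at h
      rw [h, F.Rm_swap a]; simp
    simp only [this]
    rw [show ∑ j, F.Rm (e j) a (e i) j = F.Ric a (e i) from rfl, hF.Ric_apply]
    simp only [hlam]
    simp [e, Pi.single_apply]
  have hQ' : ∀ a : ι → S, ∑ j, F.Rm a (e j) (e j) = fun i => a i * lam i := fun a => by
    ext i; rw [Finset.sum_apply, hQ]
  have hs : ∀ i j l, F.nab (e i) (e j) l = -F.nab (e i) (e l) j := fun i j l => by
    rw [nab_e, nab_e, F.skew]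
  -- The terms in which the derivative falls on the traced pair e_j, e_j cancel by skewness of Γ.
  have hz : ∀ i, ∑ j, (F.Rm (e k) (F.nab (e i) (e j)) (e j) i
      + F.Rm (e k) (e j) (F.nab (e i) (e j)) i) = 0 := fun i => by
    rw [Finset.sum_add_distrib]
    simp only [hF.Rm_apply (e k) (F.nab _ _) _ i, hF.Rm_apply (e k) _ (F.nab _ _) i]
    simp only [e, Pi.single_apply, ite_mul, one_mul, zero_mul, Finset.sum_ite_eq', Finset.mem_univ,
      if_true, mul_ite, mul_one, mul_zero, Finset.sum_ite_irrel,
      Finset.sum_const_zero]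
    rw [Finset.sum_comm, ← Finset.sum_add_distrib]
    refine Finset.sum_eq_zero fun j _ => ?_
    rw [← Finset.sum_add_distrib]
    refine Finset.sum_eq_zero fun l _ => ?_
    have := hs i j l
    simp only [e] at this
    rw [this]; ring
  have hsum : ∑ i, ∑ j, F.covRm (e i) (e k) (e j) (e j) i = 0 := by
    rw [Finset.sum_comm]; exact Finset.sum_eq_zero fun j _ => hdiv j
  have hn : ∀ i, ∑ j, F.nab (e i) (F.Rm (e k) (e j) (e j)) i
      = F.nab (e i) (fun l => (e k : ι → S) l * lam l) i := fun i => by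
    rw [← hQ' (e k)]
    have := map_sum (F.nabHom (e i)) (fun j => F.Rm (e k) (e j) (e j)) Finset.univ
    exact (Finset.sum_apply _ _ _).symm.trans (congrFun this.symm i)
  have hk : ∀ i, F.nab (e i) (fun l => (e k : ι → S) l * lam l) i
      = (if i = k then F.D k (lam k) else 0) + lam k * F.Γ i k i := fun i => by
    have : (fun l => (e k : ι → S) l * lam l) = lam k • e k := by
      ext l; by_cases h : l = k <;> simp [e, h]
    rw [this, nab_smul]
    by_cases h : i = k
    · subst h; simp [nab_e]; simp [e]; ring
    · simp [nab_e, h]; simp [e, h]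
  have hterm : ∀ i, ∑ j, F.covRm (e i) (e k) (e j) (e j) i
      = (if i = k then F.D k (lam k) else 0) + (lam k - lam i) * F.Γ i k i := fun i => by
    have h := hz i
    rw [Finset.sum_add_distrib] at h
    simp only [covRm, Pi.sub_apply, Finset.sum_sub_distrib, hn, hk, hQ, nab_e]
    linear_combination -h
  simp only [hterm, Finset.sum_add_distrib, Finset.sum_ite_eq', Finset.mem_univ, if_true] at hsum
  exact hsum

end FrameCalculus

/-! ### The differential system along the normal direction -/

section

variable {S : Type*} [CommRing S] [Algebra ℝ S]

lemma eq_zero_of_mul_of_ev {ev : S →+* ℝ} (hev : ∀ s, ev s ≠ 0 → IsUnit s) {a s : S}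
    (ha : ev a ≠ 0) (h : a * s = 0) : s = 0 :=
  (hev a ha).mul_right_eq_zero.1 h

/-- The system of differential and algebraic equations satisfied by three pairwise distinct
Ricci eigenfunctions is inconsistent. -/
theorem not_distinct_of_ode {ev : S →+* ℝ} (hev : ∀ s, ev s ≠ 0 → IsUnit s)
    (D : Derivation ℝ S S) {l0 l1 l2 l3 c d R : S} (hR : R = l0 + l1 + l2 + l3) (hDR : D R = 0)
    (h1 : D l1 = (l0 - l1) * (c * l1 + d)) (h2 : D l2 = (l0 - l2) * (c * l2 + d))
    (h3 : D l3 = (l0 - l3) * (c * l3 + d)) (hc : D c = 1 - c * (c * l0 + d))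
    (hd : 3 * D d = -R - 3 * d * (c * l0 + d))
    (hY : (6 * (l2 + l3 - l1) - R + 6 * (c * l2 + d) * (c * l3 + d))
      + (6 * (l1 + l3 - l2) - R + 6 * (c * l1 + d) * (c * l3 + d))
      + (6 * (l1 + l2 - l3) - R + 6 * (c * l1 + d) * (c * l2 + d)) = 0)
    (hYM : (6 * (l2 + l3 - l1) - R + 6 * (c * l2 + d) * (c * l3 + d)) * (2 * l1 - l2 - l3)
      + (6 * (l1 + l3 - l2) - R + 6 * (c * l1 + d) * (c * l3 + d)) * (2 * l2 - l1 - l3)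
      + (6 * (l1 + l2 - l3) - R + 6 * (c * l1 + d) * (c * l2 + d)) * (2 * l3 - l1 - l2) = 0)
    (h12 : ev l1 ≠ ev l2) (h13 : ev l1 ≠ ev l3) (h23 : ev l2 ≠ ev l3) : False := by
  have h0 : D l0 = -(D l1 + D l2 + D l3) := by
    rw [hR] at hDR; simp only [map_add] at hDR; linear_combination hDR
  -- M_i is three times the trace-free part of l_i, and the M_i are the roots of X³ + PX + Q. E is
  -- the mean curvature ∑ (c l_i + d). In the variables P, Q, E, n, c the system is closed and
  -- symmetric in the three eigenvalues.
  obtain ⟨M1, hM1⟩ : ∃ M, M = 2 * l1 - l2 - l3 := ⟨_, rfl⟩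
  obtain ⟨M2, hM2⟩ : ∃ M, M = 2 * l2 - l1 - l3 := ⟨_, rfl⟩
  obtain ⟨M3, hM3⟩ : ∃ M, M = -M1 - M2 := ⟨_, rfl⟩
  obtain ⟨P, hP⟩ : ∃ P, P = M1 * M2 + M1 * M3 + M2 * M3 := ⟨_, rfl⟩
  obtain ⟨Q, hQ⟩ : ∃ Q, Q = -(M1 * M2 * M3) := ⟨_, rfl⟩
  obtain ⟨E, hE⟩ : ∃ E, E = 3 * d + c * (l1 + l2 + l3) := ⟨_, rfl⟩
  obtain ⟨n, hn⟩ : ∃ n, n = 3 * l0 - (l1 + l2 + l3) := ⟨_, rfl⟩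
  have D2 : ∀ s : S, D (2 * s) = 2 * D s := fun s => by
    rw [two_mul, map_add, two_mul]
  have D3 : ∀ s : S, D (3 * s) = 3 * D s := fun s => by
    rw [show (3 : S) * s = s + s + s by ring, map_add, map_add]; ring
  have hM1' : 9 * D M1 = -3 * c * M1 ^ 2 + 3 * (c * n - E) * M1 - 2 * c * P := by
    rw [hP, hM3, hn, hE, hM1, hM2]; simp only [map_sub, D2, h1, h2, h3]; ring
  have hM2' : 9 * D M2 = -3 * c * M2 ^ 2 + 3 * (c * n - E) * M2 - 2 * c * P := by
    rw [hP, hM3, hn, hE, hM1, hM2]; simp only [map_sub, D2, h1, h2, h3]; ring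
  have hM3' : D M3 = -D M1 - D M2 := by rw [hM3]; simp
  have hn' : 9 * D n = -8 * c * P - 12 * E * n := by
    rw [hP, hM3, hn, hE, hM1, hM2]; simp only [map_sub, map_add, D3, h0, h1, h2, h3]; ring
  have hc' : 3 * D c = 3 - c ^ 2 * n - c * E := by
    rw [hc, hn, hE]; ring
  have hE' : 36 * D E = 8 * c ^ 2 * P - 12 * E ^ 2 - 9 * R - 9 * n := by
    have : D E = 3 * D d + c * (D l1 + D l2 + D l3) + (l1 + l2 + l3) * D c := by
      rw [hE]; simp only [map_add, D3, Derivation.leibniz, smul_eq_mul]; ring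
    rw [this, hd, h1, h2, h3, hc, hP, hM3, hn, hE, hM1, hM2, hR]; ring
  have hP' : 3 * D P = -3 * c * Q + 2 * P * (c * n - E) := by
    have h9 : 9 * (3 * D P) = 9 * (-3 * c * Q + 2 * P * (c * n - E)) := by
      have : D P = M1 * D M2 + M2 * D M1 + (M1 * D M3 + M3 * D M1) + (M2 * D M3 + M3 * D M2) := by
        rw [hP]; simp only [map_add, Derivation.leibniz, smul_eq_mul]
      rw [this, hM3', hQ]
      rw [hP] at hM1' hM2' ⊢
      rw [hM3] at hM1' hM2' ⊢
      linear_combination (3 * (M2 + -M1 - M2) - 3 * (M1 + M2)) * hM1'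
        + (3 * (M1 + -M1 - M2) - 3 * (M1 + M2)) * hM2'
    have : (9 : S) * (3 * D P - (-3 * c * Q + 2 * P * (c * n - E))) = 0 := by
      linear_combination h9
    have := eq_zero_of_mul_of_ev hev (by simp [map_ofNat]) this
    linear_combination this
  have hQ' : 9 * D Q = 2 * c * P ^ 2 + 9 * Q * (c * n - E) := by
    have : D Q = -(M1 * M2 * D M3 + M3 * (M1 * D M2 + M2 * D M1)) := by
      rw [hQ]; simp only [map_neg, Derivation.leibniz, smul_eq_mul]
    rw [this, hM3', hQ]
    rw [hP] at hM1' hM2' ⊢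
    rw [hM3] at hM1' hM2' ⊢
    linear_combination (M1 * M2 - (-M1 - M2) * M2) * hM1' + (M1 * M2 - (-M1 - M2) * M1) * hM2'
  have hE1 : 4 * c ^ 2 * P + 12 * E ^ 2 + 9 * (R - n) = 0 := by
    rw [hP, hM3, hn, hE, hM1, hM2]
    rw [hR] at hY ⊢
    linear_combination 6 * hY
  have hE2 : 2 * (c * E + 6) * P - 3 * c ^ 2 * Q = 0 := by
    have h : (2 : S) * (2 * (c * E + 6) * P - 3 * c ^ 2 * Q) = 0 := by
      rw [hQ, hP, hM3, hE, hM1, hM2]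
      linear_combination 3 * hYM
    exact eq_zero_of_mul_of_ev hev (by simp [map_ofNat]) h
  -- the discriminant
  have hdisc : -4 * ev P ^ 3 - 27 * ev Q ^ 2 > 0 := by
    have h : -4 * P ^ 3 - 27 * Q ^ 2 = (27 * ((l1 - l2) * (l1 - l3) * (l2 - l3))) ^ 2 := by
      rw [hQ, hP, hM3, hM1, hM2]; ring
    have h' := congrArg ev h
    simp only [map_sub, map_mul, map_pow, map_neg, map_ofNat] at h'
    rw [h']
    have := sub_ne_zero.2 h12
    have := sub_ne_zero.2 h13
    have := sub_ne_zero.2 h23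
    positivity
  -- A cubic X³ + PX + Q with positive discriminant has P < 0; so P is a unit, and by `hE2` c cannot
  -- vanish at the point.
  have hPneg : ev P < 0 := by
    by_contra! h
    nlinarith [pow_nonneg h 3, sq_nonneg (ev Q)]
  have hE2r := congrArg ev hE2
  simp only [map_sub, map_mul, map_pow, map_add, map_ofNat, map_zero] at hE2r
  have hc0 : ev c ≠ 0 := by
    intro h
    rw [h] at hE2r
    simp at hE2r
    exact hPneg.ne hE2r
  -- derivative of `hE2`
  have hE4 : c ^ 2 * n - 2 * (c * E) - 24 = 0 := by
    have hD : 2 * (c * E + 6) * D P + 2 * (c * D E + E * D c) * P - 3 * c ^ 2 * D Q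
        - 6 * c * D c * Q = 0 := by
      have h := congrArg D hE2
      rw [map_zero, show 2 * (c * E + 6) * P - 3 * c ^ 2 * Q
        = 2 * (c * (E * P)) + 2 * P * 6 - 3 * (c * (c * Q)) by ring] at h
      simp only [map_sub, map_add, D2, D3, Derivation.leibniz, smul_eq_mul,
        show D (2 * P * 6) = 12 * D P by
          rw [show 2 * P * 6 = 2 * (2 * (3 * P)) by ring, D2, D2, D3]; ring] at h
      linear_combination h
    -- Multiplying by c allows c²Q to be replaced through `hE2`; `hE1` removes R, and the common
    -- factor P remains.
    have hX : 0 = -108 * P * (c ^ 2 * n - 2 * (c * E) - 24) := by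
      linear_combination 36 * c * hD - c * 24 * (c * E + 6) * hP' - 2 * c ^ 2 * P * hE'
        - (24 * c * E * P - 72 * c ^ 2 * Q) * hc' + 12 * c ^ 3 * hQ'
        - (24 * (c * E + 6) + 24 * (3 - c ^ 2 * n - c * E) + 36 * (c ^ 2 * n - c * E)) * hE2
        + 2 * P * c ^ 2 * hE1
    refine eq_zero_of_mul_of_ev hev (a := 108 * P) ?_ (by linear_combination hX)
    simpa [map_ofNat] using hPneg.ne
  -- This is c times the derivative of `hE4`, with R eliminated by `hE1` and n by `hE4`; it relates
  -- only c⁴P and cE.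
  have hE5 : 7 * c ^ 4 * P + 21 * (c * E) ^ 2 + 414 * (c * E) + 1404 = 0 := by
    have hD : c ^ 2 * D n + 2 * c * D c * n - 2 * (c * D E + E * D c) = 0 := by
      have h := congrArg D hE4
      rw [map_zero, show c ^ 2 * n = c * (c * n) by ring] at h
      simp only [map_sub, D2, Derivation.leibniz, smul_eq_mul,
        show D (24 : S) = 0 from Derivation.map_natCast D 24] at h
      linear_combination h
    have hX : (8 : S) * (7 * c ^ 4 * P + 21 * (c * E) ^ 2 + 414 * (c * E) + 1404) = 0 := by
      linear_combination -36 * c * hD + 4 * c ^ 3 * hn' + 24 * (c ^ 2 * n - c * E) * hc'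
        - 2 * c ^ 2 * hE' + 2 * c ^ 2 * hE1
        + (108 - 48 * (c * E) - 24 * (c ^ 2 * n + 2 * (c * E) + 24)) * hE4
    exact eq_zero_of_mul_of_ev hev (by simp [map_ofNat]) hX
  -- In u = cE and w = c⁴P the flow is closed (`hcU`, `hcP`). Substituting w from `hE5` into the
  -- derivative of `hE5` cancels the cubic and quadratic terms in u, leaving a multiple of u + 4.
  have hU : c * E + 4 = 0 := by
    have hD : 7 * (c ^ 4 * D P + 4 * c ^ 3 * D c * P)
        + (42 * (c * E) + 414) * (c * D E + E * D c) = 0 := by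
      have h := congrArg D hE5
      rw [map_zero, show 7 * c ^ 4 * P + 21 * (c * E) ^ 2 + 414 * (c * E) + 1404
        = ((7 : ℕ) : S) * (c * (c * (c * (c * P)))) + ((21 : ℕ) : S) * ((c * E) * (c * E))
          + ((414 : ℕ) : S) * (c * E) + ((1404 : ℕ) : S) by push_cast; ring] at h
      simp only [map_add, Derivation.leibniz, smul_eq_mul, Derivation.map_natCast] at h
      push_cast at h
      linear_combination h
    have hcU : 3 * c * (c * D E + E * D c) = -3 * (c * E) ^ 2 - 24 * (c * E) - 36 + c ^ 4 * P := by
      have : (12 : S) * (3 * c * (c * D E + E * D c)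
          - (-3 * (c * E) ^ 2 - 24 * (c * E) - 36 + c ^ 4 * P)) = 0 := by
        linear_combination c ^ 2 * hE' + 12 * (c * E) * hc' - c ^ 2 * hE1
          - (12 * (c * E) + 18) * hE4
      linear_combination eq_zero_of_mul_of_ev hev (by simp [map_ofNat]) this
    have hcP : 3 * c * (c ^ 4 * D P + 4 * c ^ 3 * D c * P) = c ^ 4 * P * (-12 * (c * E) - 48) := by
      linear_combination c ^ 5 * hP' + 4 * c ^ 4 * P * hc' + c ^ 4 * hE2 - 2 * c ^ 4 * P * hE4
    have hX : (53460 : S) * (c * E + 4) = 0 := by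
      linear_combination -7 * 3 * c * hD + 49 * hcP + 7 * (42 * (c * E) + 414) * hcU
        + (-84 * (c * E) - 336 + 42 * (c * E) + 414) * hE5
    exact eq_zero_of_mul_of_ev hev (by simp [map_ofNat]) hX
  have hUr := congrArg ev hU
  have hE5r := congrArg ev hE5
  simp only [map_mul, map_pow, map_add, map_ofNat, map_zero] at hUr hE5r
  have hU4 : ev c * ev E = -4 := by linarith
  rw [hU4] at hE5r hE2r
  have hP4 : ev c ^ 4 * ev P = -12 := by linarith
  have hQ2 : ev c ^ 2 * ev Q * 3 = 4 * ev P := by linarith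
  -- From c⁴P = -12 and 3c²Q = 4P, both terms of c⁴ times the discriminant equal 48P² up to sign.
  have : ev c ^ 4 * (-4 * ev P ^ 3 - 27 * ev Q ^ 2) = 0 := by
    have : (ev c ^ 2 * ev Q * 3) ^ 2 = (4 * ev P) ^ 2 := by rw [hQ2]
    linear_combination -4 * ev P ^ 2 * hP4 - 3 * this
  have h4 : 0 < ev c ^ 4 := by positivity
  exact (mul_pos h4 hdisc).ne' this

end

/-! ### Structure equations of an adapted frame -/

namespace FrameCalculus

section

variable {ι S : Type*} [Fintype ι] [DecidableEq ι] [CommRing S] [Algebra ℝ S]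
  {F : FrameCalculus ι S}

lemma Rm_e (i j k l : ι) : F.Rm (e i) (e j) (e k) l = F.D i (F.Γ j k l) - F.D j (F.Γ i k l)
    + ∑ m, (F.Γ j k m * F.Γ i m l - F.Γ i k m * F.Γ j m l)
    - ∑ m, (F.Γ i j m - F.Γ j i m) * F.Γ m k l := by
  have h : ∀ (a : ι) (b : ι → S), F.nab (e a) b l = F.D a (b l) + ∑ m, b m * F.Γ a m l :=
    fun a b => by simp only [nab, e_act]; simp [e, Pi.single_apply]
  have h' : ∀ (b : ι → S), F.nab b (e k) l = ∑ m, b m * F.Γ m k l := fun b => by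
    conv_lhs => rw [eq_sum_e b]
    have : F.nab (∑ i, b i • e i) (e k) = ∑ i, b i • F.nab (e i) (e k) :=
      (DFunLike.congr_fun (map_sum F.nabHom (fun i => b i • e i) Finset.univ) (e k)).trans
        ((AddMonoidHom.finsetSum_apply _ _ _).trans
          (Finset.sum_congr rfl fun i _ => F.smul_nab _ _ _))
    rw [this]
    simp [nab_e]
  have h2 : ∀ a b : ι, F.nab (e a) (e b) = F.Γ a b := fun a b => funext fun m => nab_e F a b m
  simp only [Rm, Pi.sub_apply, h2, h, h', act_br_e, Finset.sum_sub_distrib]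
  ring

lemma covRic_e (lam : ι → S) (hF : F.IsLie)
    (hlam : ∀ i j, F.Ric (e i) (e j) = if i = j then lam i else 0) (i j k : ι) :
    F.covRic (e i) (e j) (e k)
      = (if j = k then F.D i (lam j) else 0) + (lam j - lam k) * F.Γ i j k := by
  have h1 : F.Ric (F.nab (e i) (e j)) (e k) = F.Γ i j k * lam k := by
    rw [hF.Ric_apply]; simp only [hlam]; simp [e, Pi.single_apply, ← nab_e]
  have h2 : F.Ric (e j) (F.nab (e i) (e k)) = F.Γ i k j * lam j := by
    rw [hF.Ric_apply]; simp only [hlam]; simp [e, Pi.single_apply, ← nab_e]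
  rw [covRic, h1, h2, hlam, F.skew i k j, e_act]
  split_ifs with h
  · ring
  · rw [map_zero]; ring

lemma codazzi_e (lam : ι → S) (hF : F.IsLie)
    (hlam : ∀ i j, F.Ric (e i) (e j) = if i = j then lam i else 0)
    (hdiv : ∀ j k l, ∑ i, F.covRm (e i) (e j) (e k) (e l) i = 0) (i j k : ι) :
    (if j = k then F.D i (lam j) else 0) + (lam j - lam k) * F.Γ i j k
      = (if i = k then F.D j (lam i) else 0) + (lam i - lam k) * F.Γ j i k := by
  rw [← covRic_e lam hF hlam, ← covRic_e lam hF hlam]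
  exact hF.codazzi _ _ _ (hdiv i j k)

/-- The traced Codazzi equation identifies dR with the divergence of Ricci, which `div_ric` shows to
vanish. -/
lemma D_scal (lam : ι → S) (hF : F.IsLie)
    (hlam : ∀ i j, F.Ric (e i) (e j) = if i = j then lam i else 0)
    (hdiv : ∀ j k l, ∑ i, F.covRm (e i) (e j) (e k) (e l) i = 0) (k : ι) :
    F.D k (∑ i, lam i) = 0 := by
  rw [map_sum, ← hF.div_ric lam hlam k fun j => hdiv k j j]
  have : ∀ i, F.D k (lam i) = (if i = k then F.D i (lam k) else 0) + (lam k - lam i) * F.Γ i k i :=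
    fun i => by
      have h := codazzi_e lam hF hlam hdiv k i i
      simp only [if_true, sub_self, zero_mul, add_zero] at h
      rw [h]
      by_cases hik : i = k
      · simp [hik]
      · simp [hik, Ne.symm hik]
  rw [Finset.sum_congr rfl fun i _ => this i, Finset.sum_add_distrib]
  simp

end

variable {S : Type*} [CommRing S] [Algebra ℝ S] {F : FrameCalculus (Fin 4) S}

/-- In a frame adapted to a solution of the equation
`∇df = φ Rc + h g`, where `dh = -(R / 3) dφ`, on a space with harmonic curvature, the
Ricci eigenfunctions `lam 1`, `lam 2`, `lam 3` are not pairwise distinct. -/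
theorem IsLie.not_distinct [IsReduced S] (hF : F.IsLie) {ev : S →+* ℝ} (hev : ∀ s, ev s ≠ 0 → IsUnit s)
    (lam : Fin 4 → S) (hlam : ∀ i j, F.Ric (e i) (e j) = if i = j then lam i else 0)
    (hdiv : ∀ j k l, ∑ i, F.covRm (e i) (e j) (e k) (e l) i = 0)
    (φ N h : S) (hφ : ∀ i, F.D i φ = if i = 0 then N else 0) (hN : ev N ≠ 0)
    (hh : ∀ i, 3 * F.D i h = -(F.D i φ * ∑ j, lam j))
    (hess : ∀ i k, F.nab (e i) (N • e 0) k = if i = k then φ * lam i + h else 0)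
    (h12 : ev (lam 1) ≠ ev (lam 2)) (h13 : ev (lam 1) ≠ ev (lam 3))
    (h23 : ev (lam 2) ≠ ev (lam 3)) : False := by
  have cancel : ∀ {a s : S}, ev a ≠ 0 → a * s = 0 → s = 0 :=
    fun ha h => eq_zero_of_mul_of_ev hev ha h
  have e3 : ev (3 : S) ≠ 0 := by simp [map_ofNat]
  have d12 : ev (lam 1 - lam 2) ≠ 0 := by rw [map_sub]; exact sub_ne_zero.2 h12
  have d13 : ev (lam 1 - lam 3) ≠ 0 := by rw [map_sub]; exact sub_ne_zero.2 h13
  have d23 : ev (lam 2 - lam 3) ≠ 0 := by rw [map_sub]; exact sub_ne_zero.2 h23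
  obtain ⟨u, hu⟩ := (hev N hN).exists_right_inv
  have hcod := codazzi_e lam hF hlam hdiv
  have hR := D_scal lam hF hlam hdiv
  obtain ⟨R, hRdef⟩ : ∃ R, R = ∑ j, lam j := ⟨_, rfl⟩
  rw [← hRdef] at hh hR
  rw [Fin.sum_univ_four] at hRdef
  obtain ⟨c, hc⟩ : ∃ c, c = φ * u := ⟨_, rfl⟩
  obtain ⟨d, hd⟩ : ∃ d, d = h * u := ⟨_, rfl⟩
  have hcN : N * c = φ := by rw [hc]; linear_combination φ * hu
  have hdN : N * d = h := by rw [hd]; linear_combination h * hu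
  -- consequences of the Hessian equation
  have Γjj : ∀ i j, F.Γ i j j = 0 := fun i j => by
    have h1 := F.skew i j j
    have : (2 : S) * F.Γ i j j = 0 := by linear_combination h1
    exact cancel (by simp [map_ofNat]) this
  have hess' : ∀ i k, N * F.Γ i 0 k + (if k = 0 then F.D i N else 0)
      = if i = k then φ * lam i + h else 0 := fun i k => by
    rw [← hess, nab_smul]
    simp only [Pi.add_apply, Pi.smul_apply, nab_e, smul_eq_mul, e_act]
    congr 1
    by_cases hk : k = 0 <;> simp [e, hk]
  have DN : ∀ i, i ≠ 0 → F.D i N = 0 := fun i hi => by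
    have := hess' i 0
    simpa [Γjj, hi] using this
  have D0N : F.D 0 N = φ * lam 0 + h := by
    have := hess' 0 0
    simpa [Γjj] using this
  have Γ0 : ∀ i k, k ≠ 0 → F.Γ i 0 k = if i = k then c * lam i + d else 0 := fun i k hk => by
    have h1 := hess' i k
    rw [if_neg hk, add_zero] at h1
    have : N * (F.Γ i 0 k - if i = k then c * lam i + d else 0) = 0 := by
      rw [mul_sub, h1]
      split_ifs
      · rw [← hcN, ← hdN]; ring
      · simp
    exact sub_eq_zero.1 (cancel hN this)
  have Γ0' : ∀ i k, k ≠ 0 → F.Γ i k 0 = -if i = k then c * lam i + d else 0 := fun i k hk => by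
    rw [F.skew, Γ0 i k hk]
  have D0u : F.D 0 u = -u ^ 2 * (φ * lam 0 + h) := by
    have h1 := congrArg (F.D 0) hu
    simp only [Derivation.leibniz, smul_eq_mul, Derivation.map_one_eq_zero, D0N] at h1
    linear_combination u * h1 - F.D 0 u * hu
  have D0c : F.D 0 c = 1 - c * (c * lam 0 + d) := by
    have : F.D 0 φ = N := by simp [hφ]
    rw [hc, hd, Derivation.leibniz, D0u, this, smul_eq_mul, smul_eq_mul]
    linear_combination hu
  have D0d : 3 * F.D 0 d = -R - 3 * d * (c * lam 0 + d) := by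
    have h1 := hh 0
    have : F.D 0 φ = N := by simp [hφ]
    rw [this] at h1
    rw [hc, hd, Derivation.leibniz, D0u, smul_eq_mul, smul_eq_mul]
    linear_combination u * h1 - R * hu
  -- derivatives of the eigenfunctions
  have D0lam : ∀ j, j ≠ 0 → F.D 0 (lam j) = (lam 0 - lam j) * (c * lam j + d) := fun j hj => by
    have h1 := hcod 0 j j
    rw [Γjj, Γ0 j j hj] at h1
    simpa [Ne.symm hj] using h1
  have Γ0jk : ∀ j k, j ≠ 0 → k ≠ 0 → j ≠ k → ev (lam j - lam k) ≠ 0 → F.Γ 0 j k = 0 :=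
    fun j k hj hk hjk hev' => by
      have h1 := hcod 0 j k
      rw [Γ0 j k hk] at h1
      simp only [if_neg hjk, if_neg (Ne.symm hk), mul_zero, zero_add] at h1
      exact cancel hev' h1
  have Γ00 : ∀ i, F.Γ 0 0 i = 0 := fun i => by
    by_cases hi : i = 0
    · rw [hi, Γjj]
    · rw [Γ0 0 i hi, if_neg (Ne.symm hi)]
  have Γ0i0 : ∀ i, F.Γ 0 i 0 = 0 := fun i => by rw [F.skew, Γ00, neg_zero]
  -- `Hor` means constant along the level sets. It survives E_0, since [E_i, E_0] has no E_0
  -- component: E_0 is geodesic and N is itself level-constant.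
  let Hor : S → Prop := fun s => ∀ i, i ≠ 0 → F.D i s = 0
  have Hor_add : ∀ {s t}, Hor s → Hor t → Hor (s + t) := fun hs ht i hi => by
    rw [map_add, hs i hi, ht i hi, add_zero]
  have Hor_sub : ∀ {s t}, Hor s → Hor t → Hor (s - t) := fun hs ht i hi => by
    rw [map_sub, hs i hi, ht i hi, sub_zero]
  have Hor_mul : ∀ {s t}, Hor s → Hor t → Hor (s * t) := fun hs ht i hi => by
    rw [Derivation.leibniz, hs i hi, ht i hi, smul_zero, smul_zero, add_zero]
  have Hor_D0 : ∀ {s}, Hor s → Hor (F.D 0 s) := fun {s} hs i hi => by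
    have h1 := hF.comm (e i) (e 0) s
    simp only [e_act, hs i hi, map_zero, sub_zero] at h1
    rw [h1, act_br_e, act, Fin.sum_univ_four, hs 1 (by decide), hs 2 (by decide),
      hs 3 (by decide), Γjj, Γ0i0]
    ring
  have Hφ : Hor φ := fun i hi => by rw [hφ, if_neg hi]
  have HN : Hor N := DN
  have Hh : Hor h := fun i hi => by
    have h1 := hh i
    rw [Hφ i hi] at h1
    exact cancel e3 (by linear_combination h1)
  have HR : Hor R := fun i _ => hR i
  have H0 : Hor (lam 0) := fun i hi => by
    have h1 := hcod i 0 0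
    rw [Γjj, Γ0i0] at h1
    simpa [hi] using h1
  -- φ may vanish at the point and cannot be cancelled. But for v = E_i s, differentiating φv = 0
  -- along E_0 gives φ E_0 v + Nv = 0; multiplying by v yields Nv² = 0, and the ring is reduced.
  have Hdiv : ∀ {s}, Hor (φ * s) → Hor s := fun {s} hs i hi => by
    have h1 := hs i hi
    rw [Derivation.leibniz, Hφ i hi, smul_zero, add_zero, smul_eq_mul] at h1
    have h2 := congrArg (F.D 0) h1
    have : F.D 0 φ = N := by simp [hφ]
    rw [map_zero, Derivation.leibniz, this, smul_eq_mul, smul_eq_mul] at h2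
    obtain ⟨v, hv⟩ : ∃ v, v = F.D i s := ⟨_, rfl⟩
    rw [← hv] at h1 h2 ⊢
    have h3 : N * v ^ 2 = 0 := by linear_combination v * h2 - F.D 0 v * h1
    have h4 := cancel hN h3
    exact pow_eq_zero_iff two_ne_zero |>.1 (cancel hN h3)
  have N0lam : ∀ j, j ≠ 0 → N * F.D 0 (lam j) = (lam 0 - lam j) * (φ * lam j + h) :=
    fun j hj => by rw [D0lam j hj, ← hcN, ← hdN]; ring
  have hl1 := N0lam 1 (by decide)
  have hl2 := N0lam 2 (by decide)
  have hl3 := N0lam 3 (by decide)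
  -- For the power sums s_k: s_1 = R - λ_0, and summing λ_j^(k-1) N E_0 λ_j expresses φ s_(k+1)
  -- through N E_0 s_k, lower power sums and level-constant functions.
  have Hs1 : Hor (lam 1 + lam 2 + lam 3) := by
    rw [show lam 1 + lam 2 + lam 3 = R - lam 0 by rw [hRdef]; ring]
    exact Hor_sub HR H0
  have Hs2 : Hor (lam 1 * lam 1 + lam 2 * lam 2 + lam 3 * lam 3) := by
    apply Hdiv
    rw [show φ * (lam 1 * lam 1 + lam 2 * lam 2 + lam 3 * lam 3)
      = (φ * lam 0 - h) * (lam 1 + lam 2 + lam 3) + (h * lam 0 + h * lam 0 + h * lam 0)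
        - N * F.D 0 (lam 1 + lam 2 + lam 3) by
      simp only [map_add]; linear_combination hl1 + hl2 + hl3]
    exact Hor_sub (Hor_add (Hor_mul (Hor_sub (Hor_mul Hφ H0) Hh) Hs1)
      (Hor_add (Hor_add (Hor_mul Hh H0) (Hor_mul Hh H0)) (Hor_mul Hh H0))) (Hor_mul HN (Hor_D0 Hs1))
  have Hs3 : Hor (lam 1 * lam 1 * lam 1 + lam 2 * lam 2 * lam 2 + lam 3 * lam 3 * lam 3) := by
    apply Hdiv
    have h2 : Hor (φ * (lam 1 * lam 1 * lam 1 + lam 2 * lam 2 * lam 2 + lam 3 * lam 3 * lam 3)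
        + φ * (lam 1 * lam 1 * lam 1 + lam 2 * lam 2 * lam 2 + lam 3 * lam 3 * lam 3)) := by
      rw [show φ * (lam 1 * lam 1 * lam 1 + lam 2 * lam 2 * lam 2 + lam 3 * lam 3 * lam 3)
          + φ * (lam 1 * lam 1 * lam 1 + lam 2 * lam 2 * lam 2 + lam 3 * lam 3 * lam 3)
        = ((φ * lam 0 - h) * (lam 1 * lam 1 + lam 2 * lam 2 + lam 3 * lam 3)
          + (φ * lam 0 - h) * (lam 1 * lam 1 + lam 2 * lam 2 + lam 3 * lam 3))
          + (h * lam 0 * (lam 1 + lam 2 + lam 3) + h * lam 0 * (lam 1 + lam 2 + lam 3))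
          - N * F.D 0 (lam 1 * lam 1 + lam 2 * lam 2 + lam 3 * lam 3) by
        simp only [map_add, Derivation.leibniz, smul_eq_mul]
        linear_combination 2 * lam 1 * hl1 + 2 * lam 2 * hl2 + 2 * lam 3 * hl3]
      have ha := Hor_mul (Hor_sub (Hor_mul Hφ H0) Hh) Hs2
      have hb := Hor_mul (Hor_mul Hh H0) Hs1
      exact Hor_sub (Hor_add (Hor_add ha ha) (Hor_add hb hb)) (Hor_mul HN (Hor_D0 Hs2))
    intro i hi
    have := h2 i hi
    rw [map_add] at this
    exact cancel (a := 2) (by simp [map_ofNat]) (by linear_combination this)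
  -- The derivatives of s_1, s_2, s_3 form a Vandermonde system in the E_i λ_j, invertible because
  -- the λ_j are distinct.
  have Hlam : ∀ i, i ≠ 0 → F.D i (lam 1) = 0 ∧ F.D i (lam 2) = 0 ∧ F.D i (lam 3) = 0 := by
    intro i hi
    have p1 := Hs1 i hi
    have p2 := Hs2 i hi
    have p3 := Hs3 i hi
    simp only [map_add, Derivation.leibniz, smul_eq_mul] at p1 p2 p3
    have q2 : 2 * (lam 1 * F.D i (lam 1) + lam 2 * F.D i (lam 2) + lam 3 * F.D i (lam 3)) = 0 := by
      linear_combination p2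
    have q3 : 3 * (lam 1 ^ 2 * F.D i (lam 1) + lam 2 ^ 2 * F.D i (lam 2)
        + lam 3 ^ 2 * F.D i (lam 3)) = 0 := by
      linear_combination p3
    have r2 := cancel (by simp [map_ofNat]) q2
    have r3 := cancel e3 q3
    refine ⟨cancel d12 (cancel d13 ?_), cancel d12 (cancel d23 ?_), cancel d13 (cancel d23 ?_)⟩
    · linear_combination r3 - (lam 2 + lam 3) * r2 + lam 2 * lam 3 * p1
    · linear_combination -r3 + (lam 1 + lam 3) * r2 - lam 1 * lam 3 * p1
    · linear_combination r3 - (lam 1 + lam 2) * r2 + lam 1 * lam 2 * p1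
  -- the connection coefficients of the level hypersurfaces
  have Γjij : ∀ i j, i ≠ j → F.D i (lam j) = 0 → ev (lam i - lam j) ≠ 0 → F.Γ j i j = 0 :=
    fun i j hij hD hev' => by
      have h1 := hcod i j j
      simp only [if_true, hD, if_neg hij, sub_self, zero_mul, zero_add] at h1
      exact cancel hev' h1.symm
  have Γjji : ∀ i j, F.Γ j i j = 0 → F.Γ j j i = 0 := fun i j hij => by rw [F.skew, hij, neg_zero]
  have d21 : ev (lam 2 - lam 1) ≠ 0 := by rw [map_sub]; exact sub_ne_zero.2 h12.symm
  have d31 : ev (lam 3 - lam 1) ≠ 0 := by rw [map_sub]; exact sub_ne_zero.2 h13.symm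
  have d32 : ev (lam 3 - lam 2) ≠ 0 := by rw [map_sub]; exact sub_ne_zero.2 h23.symm
  have g212 := Γjij 1 2 (by decide) (Hlam 1 (by decide)).2.1 d12
  have g313 := Γjij 1 3 (by decide) (Hlam 1 (by decide)).2.2 d13
  have g121 := Γjij 2 1 (by decide) (Hlam 2 (by decide)).1 d21
  have g323 := Γjij 2 3 (by decide) (Hlam 2 (by decide)).2.2 d23
  have g131 := Γjij 3 1 (by decide) (Hlam 3 (by decide)).1 d31
  have g232 := Γjij 3 2 (by decide) (Hlam 3 (by decide)).2.1 d32
  have g221 := Γjji _ _ g212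
  have g331 := Γjji _ _ g313
  have g112 := Γjji _ _ g121
  have g332 := Γjji _ _ g323
  have g113 := Γjji _ _ g131
  have g223 := Γjji _ _ g232
  have g012 := Γ0jk 1 2 (by decide) (by decide) (by decide) d12
  have g013 := Γ0jk 1 3 (by decide) (by decide) (by decide) d13
  have g021 := Γ0jk 2 1 (by decide) (by decide) (by decide) d21
  have g023 := Γ0jk 2 3 (by decide) (by decide) (by decide) d23
  have g031 := Γ0jk 3 1 (by decide) (by decide) (by decide) d31
  have g032 := Γ0jk 3 2 (by decide) (by decide) (by decide) d32
  -- Up to skewness, the coefficients with three distinct tangential indices are all that remains of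
  -- the intrinsic connection of the level sets.
  obtain ⟨A, hA⟩ : ∃ A, F.Γ 1 2 3 = A := ⟨_, rfl⟩
  obtain ⟨B, hB⟩ : ∃ B, F.Γ 2 3 1 = B := ⟨_, rfl⟩
  obtain ⟨C, hC⟩ : ∃ C, F.Γ 3 1 2 = C := ⟨_, rfl⟩
  have hA' : F.Γ 1 3 2 = -A := by rw [F.skew, hA]
  have hB' : F.Γ 2 1 3 = -B := by rw [F.skew, hB]
  have hC' : F.Γ 3 2 1 = -C := by rw [F.skew, hC]
  have hAB : (lam 2 - lam 3) * A = (lam 3 - lam 1) * B := by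
    have h1 := hcod 1 2 3
    rw [hA, hB'] at h1
    simp only [show (2 : Fin 4) ≠ 3 by decide, show (1 : Fin 4) ≠ 3 by decide, if_false] at h1
    linear_combination h1
  have hBC : (lam 3 - lam 1) * B = (lam 1 - lam 2) * C := by
    have h1 := hcod 2 3 1
    rw [hB, hC'] at h1
    simp only [show (3 : Fin 4) ≠ 1 by decide, show (2 : Fin 4) ≠ 1 by decide, if_false] at h1
    linear_combination h1
  -- the Ricci equations
  have hric : ∀ i, lam i = ∑ k, F.Rm (e k) (e i) (e i) k := fun i => by
    rw [← if_pos (rfl : i = i) (t := lam i) (e := 0), ← hlam i i]; rfl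
  -- This is the Riccati equation of the level sets: it gives the radial sectional curvatures K_0j =
  -- R/3 - λ_j.
  have hζ : ∀ j, j ≠ 0 → 3 * (F.D 0 (c * lam j + d) + (c * lam j + d) ^ 2) = 3 * lam j - R :=
    fun j hj => by
      simp only [map_add, Derivation.leibniz, smul_eq_mul, D0c, D0lam j hj]
      linear_combination D0d
  have k1 := hric 1
  have k2 := hric 2
  have k3 := hric 3
  have f10 : (1 : Fin 4) ≠ 0 := by decide
  have f20 : (2 : Fin 4) ≠ 0 := by decide
  have f30 : (3 : Fin 4) ≠ 0 := by decide
  have f12 : (1 : Fin 4) ≠ 2 := by decide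
  have f13 : (1 : Fin 4) ≠ 3 := by decide
  have f23 : (2 : Fin 4) ≠ 3 := by decide
  simp only [Rm_e, Fin.sum_univ_four, Γjj, Γ0i0, Γ0 _ 1 f10, Γ0 _ 2 f20, Γ0 _ 3 f30,
    Γ0' _ 1 f10, Γ0' _ 2 f20, Γ0' _ 3 f30, g212, g313, g121, g323, g131, g232, g221, g331, g112,
    g332, g113, g223, g012, g013, g021, g023, g031, g032, hA, hB, hC, hA', hB', hC', if_true,
    f12, f13, f23, f10.symm, f20.symm, f30.symm, f12.symm, f13.symm, f23.symm,
    if_false, neg_zero, map_neg, map_zero] at k1 k2 k3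
  have z1 := hζ 1 f10
  have z2 := hζ 2 f20
  have z3 := hζ 3 f30
  -- Knowing the K_0j, the three Ricci equations determine the tangential sectional curvatures: 6
  -- K_12 = 6(λ_1 + λ_2 - λ_3) - R. Adding 6 ζ_1 ζ_2 gives, by Gauss, six times the intrinsic
  -- curvature of the level set.
  have K12 : 6 * (lam 1 + lam 2 - lam 3) - R + 6 * (c * lam 1 + d) * (c * lam 2 + d)
      = 6 * (C * (A + B) - A * B) := by
    linear_combination 3 * (k1 + k2 - k3) - (z1 + z2 - z3)
  have K23 : 6 * (lam 2 + lam 3 - lam 1) - R + 6 * (c * lam 2 + d) * (c * lam 3 + d)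
      = 6 * (A * (B + C) - B * C) := by
    linear_combination 3 * (k2 + k3 - k1) - (z2 + z3 - z1)
  have K13 : 6 * (lam 1 + lam 3 - lam 2) - R + 6 * (c * lam 1 + d) * (c * lam 3 + d)
      = 6 * (B * (C + A) - C * A) := by
    linear_combination 3 * (k1 + k3 - k2) - (z1 + z3 - z2)
  -- A, B, C are proportional to the reciprocals of three differences with sum zero. Thus the level
  -- sets are scalar-flat, and each intrinsic curvature reduces to -2 times a product such as BC,
  -- whose sum weighted by the M_i telescopes.
  have hs : A * B + B * C + C * A = 0 := cancel d12 (by linear_combination -(A + B) * hBC - B * hAB)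
  refine not_distinct_of_ode hev (F.D 0) hRdef (hR 0) (D0lam 1 f10) (D0lam 2 f20) (D0lam 3 f30)
    D0c D0d ?_ ?_ h12 h13 h23
  · rw [K12, K23, K13]; linear_combination 6 * hs
  · rw [K12, K23, K13]
    linear_combination -12 * (A * hBC - B * (hAB + hBC) + C * hAB)

end FrameCalculus

end RiemGeom

/-! ### Germs of smooth functions and vector fields -/

noncomputable section

namespace RiemGeom

section

variable {n : ℕ} {M : Type*} [TopologicalSpace M] [ChartedSpace (EuclideanSpace ℝ (Fin n)) M]

variable (n) in
/-- The functions which are smooth near `p`. -/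
def smoothNear (p : M) : Subalgebra ℝ (M → ℝ) where
  carrier := {g | ∀ᶠ q in 𝓝 p, ContMDiffAt (𝓡 n) 𝓘(ℝ, ℝ) ∞ g q}
  mul_mem' := fun ha hb => by filter_upwards [ha, hb] with q h1 h2 using h1.mul h2
  add_mem' := fun ha hb => by filter_upwards [ha, hb] with q h1 h2 using h1.add h2
  algebraMap_mem' := fun r => Filter.Eventually.of_forall fun q => contMDiffAt_const

variable (n) in
/-- The functions which vanish near `p`. -/
def vanishNear (p : M) : Ideal (smoothNear n p) where
  carrier := {g | ∀ᶠ q in 𝓝 p, (g : M → ℝ) q = 0}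
  add_mem' := fun {a b} ha hb => by
    filter_upwards [ha, hb] with q h1 h2
    simp [h1, h2]
  zero_mem' := Filter.Eventually.of_forall fun q => rfl
  smul_mem' := fun c {a} ha => by
    filter_upwards [ha] with q h1
    simp [h1]

variable (n) in
/-- The ring of germs at `p` of smooth functions. -/
def GermRing (p : M) : Type _ := smoothNear n p ⧸ vanishNear n p

instance (p : M) : CommRing (GermRing n p) :=
  inferInstanceAs (CommRing (smoothNear n p ⧸ vanishNear n p))

instance (p : M) : Algebra ℝ (GermRing n p) :=
  inferInstanceAs (Algebra ℝ (smoothNear n p ⧸ vanishNear n p))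

/-- The germ of a function which is smooth near `p`. -/
def toGerm {p : M} (g : M → ℝ) (hg : g ∈ smoothNear n p) : GermRing n p :=
  Ideal.Quotient.mk (vanishNear n p) ⟨g, hg⟩

variable {p : M}

lemma toGerm_eq {g g' : M → ℝ} {hg : g ∈ smoothNear n p} {hg' : g' ∈ smoothNear n p} :
    toGerm g hg = toGerm g' hg' ↔ g =ᶠ[𝓝 p] g' := by
  refine (Ideal.Quotient.eq (I := vanishNear n p)).trans ?_
  change (∀ᶠ q in 𝓝 p, g q - g' q = 0) ↔ _
  simp only [sub_eq_zero]; rfl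

lemma exists_toGerm (s : GermRing n p) : ∃ g hg, s = toGerm (n := n) (p := p) g hg := by
  obtain ⟨⟨g, hg⟩, rfl⟩ := Ideal.Quotient.mk_surjective s
  exact ⟨g, hg, rfl⟩

lemma toGerm_add {g g' : M → ℝ} (hg : g ∈ smoothNear n p) (hg' : g' ∈ smoothNear n p) :
    toGerm g hg + toGerm g' hg' = toGerm (fun q => g q + g' q) (add_mem hg hg') := rfl

lemma toGerm_sub {g g' : M → ℝ} (hg : g ∈ smoothNear n p) (hg' : g' ∈ smoothNear n p) :
    toGerm g hg - toGerm g' hg' = toGerm (fun q => g q - g' q) (sub_mem hg hg') := rfl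

lemma toGerm_mul {g g' : M → ℝ} (hg : g ∈ smoothNear n p) (hg' : g' ∈ smoothNear n p) :
    toGerm g hg * toGerm g' hg' = toGerm (fun q => g q * g' q) (mul_mem hg hg') := rfl

lemma sum_mem_smoothNear {κ : Type*} (t : Finset κ) {g : κ → M → ℝ}
    (hg : ∀ k, g k ∈ smoothNear n p) : (fun q => ∑ k ∈ t, g k q) ∈ smoothNear n p := by
  have := sum_mem (S := smoothNear n p) (t := t) fun k _ => hg k
  convert this using 1
  ext q; simp

lemma toGerm_sum {κ : Type*} (t : Finset κ) {g : κ → M → ℝ} (hg : ∀ k, g k ∈ smoothNear n p) :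
    ∑ k ∈ t, toGerm (g k) (hg k) = toGerm (fun q => ∑ k ∈ t, g k q) (sum_mem_smoothNear t hg) := by
  have : ∑ k ∈ t, toGerm (g k) (hg k)
      = Ideal.Quotient.mk (vanishNear n p) (∑ k ∈ t, ⟨g k, hg k⟩) := (map_sum _ _ _).symm
  rw [this]
  refine congrArg (Ideal.Quotient.mk (vanishNear n p)) ?_
  apply Subtype.ext
  ext q
  simp

lemma sum_mul_mem_smoothNear {κ : Type*} (t : Finset κ) {g g' : κ → M → ℝ}
    (hg : ∀ k, g k ∈ smoothNear n p) (hg' : ∀ k, g' k ∈ smoothNear n p) :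
    (fun q => ∑ k ∈ t, g k q * g' k q) ∈ smoothNear n p :=
  sum_mem_smoothNear t fun k => mul_mem (hg k) (hg' k)

lemma toGerm_sum_mul {κ : Type*} (t : Finset κ) {g g' : κ → M → ℝ}
    (hg : ∀ k, g k ∈ smoothNear n p) (hg' : ∀ k, g' k ∈ smoothNear n p) :
    ∑ k ∈ t, toGerm (g k) (hg k) * toGerm (g' k) (hg' k)
      = toGerm (fun q => ∑ k ∈ t, g k q * g' k q) (sum_mul_mem_smoothNear t hg hg') :=
  toGerm_sum t fun k => mul_mem (hg k) (hg' k)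

lemma const_mem_smoothNear (r : ℝ) : (fun _ => r) ∈ smoothNear n p :=
  Filter.Eventually.of_forall fun _ => contMDiffAt_const

lemma toGerm_const (r : ℝ) : toGerm (n := n) (p := p) (fun _ => r) (const_mem_smoothNear r)
    = algebraMap ℝ _ r := rfl

/-- The value at `p` of a germ at `p`. -/
def germEval (p : M) : GermRing n p →+* ℝ :=
  Ideal.Quotient.lift _ ((Pi.evalRingHom (fun _ => ℝ) p).comp (smoothNear n p).val.toRingHom)
    fun _ ha => ha.self_of_nhds

@[simp] lemma germEval_toGerm (g : M → ℝ) (hg : g ∈ smoothNear n p) :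
    germEval p (toGerm g hg) = g p := rfl

lemma isUnit_of_germEval_ne_zero (s : GermRing n p) (hs : germEval p s ≠ 0) : IsUnit s := by
  obtain ⟨g, hg, rfl⟩ := exists_toGerm s
  rw [germEval_toGerm] at hs
  have hc : ContinuousAt g p := hg.self_of_nhds.continuousAt
  have hne : ∀ᶠ q in 𝓝 p, g q ≠ 0 := hc.eventually_ne hs
  have hi : (fun q => (g q)⁻¹) ∈ smoothNear n p := by
    filter_upwards [hg, hne] with q h1 h2 using h1.inv₀ h2
  refine isUnit_iff_exists_inv.2 ⟨toGerm _ hi, ?_⟩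
  rw [toGerm_mul, ← map_one (algebraMap ℝ _), ← toGerm_const, toGerm_eq]
  filter_upwards [hne] with q h2 using mul_inv_cancel₀ h2

instance : IsReduced (GermRing n p) := ⟨fun s hs => by
  obtain ⟨m, hm⟩ := hs
  obtain ⟨g, hg, rfl⟩ := exists_toGerm s
  have h0 : (0 : GermRing n p) = toGerm (fun _ => 0) (const_mem_smoothNear 0) := rfl
  have : toGerm g hg ^ m = toGerm (g ^ m) (pow_mem hg m) := rfl
  rw [this, h0, toGerm_eq] at hm
  rw [h0, toGerm_eq]
  filter_upwards [hm] with q hq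
  exact eq_zero_of_pow_eq_zero hq⟩

lemma mdifferentiableAt_of_mem {g : M → ℝ} (hg : g ∈ smoothNear n p) :
    MDifferentiableAt (𝓡 n) 𝓘(ℝ, ℝ) g p :=
  hg.self_of_nhds.mdifferentiableAt (by simp)

variable [IsManifold (𝓡 n) ∞ M]

/-- The vector field `X` is smooth near `p`. -/
def SmoothFieldNear (X : Field n M) (p : M) : Prop :=
  ∀ᶠ q in 𝓝 p, ContMDiffAt (𝓡 n) (𝓡 n).tangent ∞ (fun q => (⟨q, X q⟩ : TangentBundle (𝓡 n) M)) q

lemma SmoothFieldNear.eventually {X : Field n M} (h : SmoothFieldNear X p) :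
    ∀ᶠ q in 𝓝 p, SmoothFieldNear X q := eventually_eventually_nhds.2 h

lemma SmoothFieldNear.congr {X Y : Field n M} (h : SmoothFieldNear X p) (hXY : X =ᶠ[𝓝 p] Y) :
    SmoothFieldNear Y p := by
  filter_upwards [h, hXY.eventually_nhds] with q h1 h2
  refine h1.congr_of_eventuallyEq ?_
  filter_upwards [h2] with z hz
  rw [hz]

lemma SmoothFieldNear.add {X Y : Field n M} (hX : SmoothFieldNear X p) (hY : SmoothFieldNear Y p) :
    SmoothFieldNear (X + Y) p := by
  filter_upwards [hX, hY] with q h1 h2 using h1.add_section h2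

lemma SmoothFieldNear.sub {X Y : Field n M} (hX : SmoothFieldNear X p) (hY : SmoothFieldNear Y p) :
    SmoothFieldNear (X - Y) p := by
  filter_upwards [hX, hY] with q h1 h2 using h1.sub_section h2

lemma SmoothFieldNear.smul {X : Field n M} {g : M → ℝ} (hg : g ∈ smoothNear n p)
    (hX : SmoothFieldNear X p) : SmoothFieldNear (g • X) p := by
  filter_upwards [hg, hX] with q h1 h2 using h1.smul_section h2

lemma SmoothFieldNear.sum {κ : Type*} {X : κ → Field n M} {t : Finset κ}
    (hX : ∀ k, SmoothFieldNear (X k) p) : SmoothFieldNear (fun q => ∑ k ∈ t, X k q) p := by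
  have : ∀ᶠ q in 𝓝 p, ∀ k ∈ t, ContMDiffAt (𝓡 n) (𝓡 n).tangent ∞
      (fun q => (⟨q, X k q⟩ : TangentBundle (𝓡 n) M)) q := by
    rw [Filter.eventually_all_finset]; exact fun k _ => hX k
  filter_upwards [this] with q h1 using .sum_section h1

lemma SmoothFieldNear.ext (v : TangentSpace (𝓡 n) p) : SmoothFieldNear (ext v) p := by
  obtain ⟨s, hs, h⟩ := FiberBundle.exists_contMDiffOn_extend (k := ∞) (𝓡 n)
    (EuclideanSpace ℝ (Fin n)) (V := fun p : M => TangentSpace (𝓡 n) p) v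
  filter_upwards [eventually_mem_nhds_iff.2 hs] with q hq
  exact h.contMDiffAt hq

lemma ext_self (v : TangentSpace (𝓡 n) p) : RiemGeom.ext v p = v :=
  FiberBundle.extend_apply_self _ v

lemma SmoothFieldNear.mlieBracket {X Y : Field n M} (hX : SmoothFieldNear X p)
    (hY : SmoothFieldNear Y p) : SmoothFieldNear (VectorField.mlieBracket (𝓡 n) X Y) p := by
  filter_upwards [hX, hY] with q h1 h2
  have : IsManifold (𝓡 n) (minSmoothness ℝ 2) M := by
    rw [minSmoothness_of_isRCLikeNormedField]; infer_instance
  have : IsManifold (𝓡 n) (((⊤ : ℕ∞) : ℕ∞ω) + 1) M := inferInstanceAs (IsManifold (𝓡 n) ∞ M)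
  exact ContMDiffAt.mlieBracket_vectorField (n := ⊤) (m := ⊤) h1 h2 (by simp)

lemma SmoothFieldNear.mdifferentiableAt {X : Field n M} (hX : SmoothFieldNear X p) :
    MDifferentiableAt (𝓡 n) (𝓡 n).tangent (fun q => (⟨q, X q⟩ : TangentBundle (𝓡 n) M)) p :=
  hX.self_of_nhds.mdifferentiableAt (by simp)

variable [RiemannianBundle (fun p : M => TangentSpace (𝓡 n) p)]
  [IsContMDiffRiemannianBundle (𝓡 n) ∞ (EuclideanSpace ℝ (Fin n))
      (fun p : M => TangentSpace (𝓡 n) p)]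

lemma SmoothFieldNear.inner {X Y : Field n M} (hX : SmoothFieldNear X p)
    (hY : SmoothFieldNear Y p) : (fun q => inner ℝ (X q) (Y q)) ∈ smoothNear n p := by
  filter_upwards [hX, hY] with q h1 h2
  exact ContMDiffAt.inner_bundle (IB := 𝓡 n) (F := EuclideanSpace ℝ (Fin n))
    (E := fun p : M => TangentSpace (𝓡 n) p) h1 h2

end

/-! ### Directional derivatives of germs and orthonormal frames -/

section

variable {n : ℕ} {M : Type*} [TopologicalSpace M] [ChartedSpace (EuclideanSpace ℝ (Fin n)) M]
  {p : M}

lemma dirDeriv_congr {g g' : M → ℝ} (h : g =ᶠ[𝓝 p] g') (v : TangentSpace (𝓡 n) p) :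
    dirDeriv g p v = dirDeriv g' p v := by
  simp only [dirDeriv, mvfderiv, ContinuousLinearMap.comp_apply, h.mfderiv_eq]
  rfl

lemma dirDeriv_add {g g' : M → ℝ} (hg : g ∈ smoothNear n p) (hg' : g' ∈ smoothNear n p)
    (v : TangentSpace (𝓡 n) p) :
    dirDeriv (fun q => g q + g' q) p v = dirDeriv g p v + dirDeriv g' p v := by
  simp only [dirDeriv]
  rw [mvfderiv_fun_add (mdifferentiableAt_of_mem hg) (mdifferentiableAt_of_mem hg')]
  rfl

lemma dirDeriv_mul {g g' : M → ℝ} (hg : g ∈ smoothNear n p) (hg' : g' ∈ smoothNear n p)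
    (v : TangentSpace (𝓡 n) p) :
    dirDeriv (fun q => g q * g' q) p v = g p * dirDeriv g' p v + g' p * dirDeriv g p v := by
  simp only [dirDeriv]
  rw [mvfderiv_fun_mul (mdifferentiableAt_of_mem hg) (mdifferentiableAt_of_mem hg')]
  rfl

lemma dirDeriv_const (r : ℝ) (v : TangentSpace (𝓡 n) p) :
    dirDeriv (fun _ => r) p v = 0 := by
  simp only [dirDeriv]
  rw [mvfderiv_const]
  rfl

lemma dirDeriv_vec_sum {κ : Type*} (t : Finset κ) (g : M → ℝ) (a : κ → ℝ)
    (v : κ → TangentSpace (𝓡 n) p) :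
    dirDeriv g p (∑ k ∈ t, a k • v k) = ∑ k ∈ t, a k * dirDeriv g p (v k) := by
  simp only [dirDeriv, map_sum, map_smul, smul_eq_mul]

/-- The derivative of germs along a vector field. -/
def dirGerm (X : Field n M)
    (h : ∀ g ∈ smoothNear n p, (fun q => dirDeriv g q (X q)) ∈ smoothNear n p)
    (s : GermRing n p) : GermRing n p :=
  toGerm (fun q => dirDeriv (exists_toGerm s).choose q (X q))
    (h _ (exists_toGerm s).choose_spec.choose)

lemma dirGerm_toGerm (X : Field n M)
    (h : ∀ g ∈ smoothNear n p, (fun q => dirDeriv g q (X q)) ∈ smoothNear n p)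
    (g : M → ℝ) (hg : g ∈ smoothNear n p) :
    dirGerm X h (toGerm g hg) = toGerm (fun q => dirDeriv g q (X q)) (h g hg) := by
  rw [dirGerm, toGerm_eq]
  have := toGerm_eq.1 (exists_toGerm (toGerm g hg)).choose_spec.choose_spec
  filter_upwards [this.eventually_nhds] with q hq
  exact dirDeriv_congr (Filter.EventuallyEq.symm hq) _

/-- The derivation of the ring of germs given by a vector field. -/
def dirDerivation (X : Field n M)
    (h : ∀ g ∈ smoothNear n p, (fun q => dirDeriv g q (X q)) ∈ smoothNear n p) :
    Derivation ℝ (GermRing n p) (GermRing n p) :=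
  have hmul : ∀ s t, dirGerm X h (s * t) = s * dirGerm X h t + t * dirGerm X h s := fun s t => by
    obtain ⟨g, hg, rfl⟩ := exists_toGerm s
    obtain ⟨g', hg', rfl⟩ := exists_toGerm t
    rw [toGerm_mul, dirGerm_toGerm, dirGerm_toGerm, dirGerm_toGerm, toGerm_mul, toGerm_mul,
      toGerm_add, toGerm_eq]
    filter_upwards [eventually_eventually_nhds.2 hg, eventually_eventually_nhds.2 hg'] with q h1 h2
    exact dirDeriv_mul h1 h2 _
  Derivation.mk'
    { toFun := dirGerm X h
      map_add' := fun s t => by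
        obtain ⟨g, hg, rfl⟩ := exists_toGerm s
        obtain ⟨g', hg', rfl⟩ := exists_toGerm t
        rw [toGerm_add, dirGerm_toGerm, dirGerm_toGerm, dirGerm_toGerm, toGerm_add, toGerm_eq]
        filter_upwards [eventually_eventually_nhds.2 hg, eventually_eventually_nhds.2 hg']
          with q h1 h2
        exact dirDeriv_add h1 h2 _
      map_smul' := fun r s => by
        have hr : dirGerm X h (algebraMap ℝ (GermRing n p) r) = 0 := by
          rw [← toGerm_const, dirGerm_toGerm,
            show (0 : GermRing n p) = toGerm (fun _ => 0) (const_mem_smoothNear 0) from rfl,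
            toGerm_eq]
          exact Filter.Eventually.of_forall fun q => dirDeriv_const r _
        rw [Algebra.smul_def, hmul, hr, mul_zero, add_zero, RingHom.id_apply, Algebra.smul_def] }
    hmul

lemma dirDerivation_toGerm (X : Field n M)
    (h : ∀ g ∈ smoothNear n p, (fun q => dirDeriv g q (X q)) ∈ smoothNear n p)
    (g : M → ℝ) (hg : g ∈ smoothNear n p) :
    dirDerivation X h (toGerm g hg) = toGerm (fun q => dirDeriv g q (X q)) (h g hg) :=
  dirGerm_toGerm X h g hg

variable [IsManifold (𝓡 n) ∞ M] [RiemannianBundle (fun p : M => TangentSpace (𝓡 n) p)]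

/-- The vector fields `E i` form a smooth orthonormal frame near `p`. -/
structure IsFrameNear (E : Fin n → Field n M) (p : M) : Prop where
  smooth : ∀ i, SmoothFieldNear (E i) p
  orthonormal : ∀ᶠ q in 𝓝 p, Orthonormal ℝ (fun i => E i q)

variable {E : Fin n → Field n M}

lemma IsFrameNear.eventually (hE : IsFrameNear E p) : ∀ᶠ q in 𝓝 p, IsFrameNear E q := by
  filter_upwards [Filter.eventually_all.2 fun i => (hE.smooth i).eventually,
    eventually_eventually_nhds.2 hE.orthonormal] with q h1 h2 using ⟨h1, h2⟩

/-- The frame at the point `p`. -/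
def IsFrameNear.basis (hE : IsFrameNear E p) :
    OrthonormalBasis (Fin n) ℝ (TangentSpace (𝓡 n) p) :=
  OrthonormalBasis.mk hE.orthonormal.self_of_nhds (by
    rw [hE.orthonormal.self_of_nhds.linearIndependent.span_eq_top_of_card_eq_finrank']
    rw [Fintype.card_fin]
    exact (finrank_euclideanSpace_fin (𝕜 := ℝ) (n := n)).symm)

@[simp] lemma IsFrameNear.basis_apply (hE : IsFrameNear E p) (i : Fin n) :
    hE.basis i = E i p := by simp [IsFrameNear.basis]

lemma IsFrameNear.expand (hE : IsFrameNear E p) (v : TangentSpace (𝓡 n) p) :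
    v = ∑ i, inner ℝ v (E i p) • E i p := by
  conv_lhs => rw [← hE.basis.sum_repr' v]
  simp only [IsFrameNear.basis_apply, real_inner_comm]

lemma IsFrameNear.inner_expand (hE : IsFrameNear E p) (v w : TangentSpace (𝓡 n) p) :
    inner ℝ v w = ∑ i, inner ℝ v (E i p) * inner ℝ w (E i p) := by
  rw [← hE.basis.sum_inner_mul_inner v w]
  simp only [IsFrameNear.basis_apply]
  exact Finset.sum_congr rfl fun i _ => by rw [real_inner_comm w]

lemma IsFrameNear.inner_self (hE : IsFrameNear E p) (i j : Fin n) :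
    inner ℝ (E i p) (E j p) = if i = j then (1 : ℝ) else 0 :=
  orthonormal_iff_ite.1 hE.orthonormal.self_of_nhds i j

variable [IsContMDiffRiemannianBundle (𝓡 n) ∞ (EuclideanSpace ℝ (Fin n))
      (fun p : M => TangentSpace (𝓡 n) p)]

lemma IsFrameNear.smoothFieldNear (hE : IsFrameNear E p) {X : Field n M}
    (hX : ∀ i, (fun q => inner ℝ (X q) (E i q)) ∈ smoothNear n p) : SmoothFieldNear X p := by
  have h := SmoothFieldNear.sum (t := Finset.univ) fun i => SmoothFieldNear.smul (hX i) (hE.smooth i)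
  refine h.congr ?_
  filter_upwards [hE.eventually] with q hq
  exact (hq.expand (X q)).symm

/-- The smooth bracket [E_i, g E_i] equals (E_i g) E_i + g [E_i, E_i], so its E_i component isolates
E_i g. -/
lemma IsFrameNear.dirDeriv_mem_frame (hE : IsFrameNear E p) (i : Fin n) (g : M → ℝ)
    (hg : g ∈ smoothNear n p) : (fun q => dirDeriv g q (E i q)) ∈ smoothNear n p := by
  have h1 := ((hE.smooth i).mlieBracket (SmoothFieldNear.smul hg (hE.smooth i))).inner (hE.smooth i)
  have h2 := mul_mem hg (((hE.smooth i).mlieBracket (hE.smooth i)).inner (hE.smooth i))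
  have h3 := sub_mem h1 h2
  have h4 : ∀ᶠ q in 𝓝 p, dirDeriv g q (E i q)
      = inner ℝ (VectorField.mlieBracket (𝓡 n) (E i) (g • E i) q) (E i q)
        - g q * inner ℝ (VectorField.mlieBracket (𝓡 n) (E i) (E i) q) (E i q) := by
    filter_upwards [hE.eventually, eventually_eventually_nhds.2 hg] with q h1 h2
    rw [VectorField.mlieBracket_smul_right (mdifferentiableAt_of_mem h2) (h1.smooth i).mdifferentiableAt,
      inner_add_left, real_inner_smul_left, real_inner_smul_left, h1.inner_self]
    simp [dirDeriv]
  filter_upwards [h3, h4.eventually_nhds] with q h5 h6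
  exact h5.congr_of_eventuallyEq h6

end

/-! ### Lie brackets in a frame -/

section

variable {n : ℕ} {M : Type*} [TopologicalSpace M] [ChartedSpace (EuclideanSpace ℝ (Fin n)) M]
  {p : M} [IsManifold (𝓡 n) ∞ M]

lemma mlieBracket_sum_smul {κ : Type*} (t : Finset κ) {X : Field n M} {Y : κ → Field n M}
    {b : κ → M → ℝ} (hY : ∀ k, SmoothFieldNear (Y k) p) (hb : ∀ k, b k ∈ smoothNear n p) :
    VectorField.mlieBracket (𝓡 n) X (∑ k ∈ t, b k • Y k) p
      = ∑ k ∈ t, (dirDeriv (b k) p (X p) • Y k p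
        + b k p • VectorField.mlieBracket (𝓡 n) X (Y k) p) := by
  classical
  induction t using Finset.induction with
  | empty => simp
  | insert a s ha ih =>
    have h1 : SmoothFieldNear (∑ k ∈ s, b k • Y k) p := by
      have := SmoothFieldNear.sum (t := s) fun k => SmoothFieldNear.smul (hb k) (hY k)
      refine this.congr (Filter.Eventually.of_forall fun q => ?_)
      rw [Finset.sum_apply]
    rw [Finset.sum_insert ha, Finset.sum_insert ha, VectorField.mlieBracket_add_right
      (SmoothFieldNear.smul (hb a) (hY a)).mdifferentiableAt h1.mdifferentiableAt,
      VectorField.mlieBracket_smul_right (mdifferentiableAt_of_mem (hb a))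
      (hY a).mdifferentiableAt, ih]
    rfl

variable [RiemannianBundle (fun p : M => TangentSpace (𝓡 n) p)]
  [IsContMDiffRiemannianBundle (𝓡 n) ∞ (EuclideanSpace ℝ (Fin n))
      (fun p : M => TangentSpace (𝓡 n) p)]

variable {E : Fin n → Field n M}

lemma IsFrameNear.dirDeriv_mem (hE : IsFrameNear E p) {X : Field n M} (hX : SmoothFieldNear X p)
    {g : M → ℝ} (hg : g ∈ smoothNear n p) :
    (fun q => dirDeriv g q (X q)) ∈ smoothNear n p := by
  have h := sum_mem_smoothNear Finset.univ fun i =>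
    mul_mem (hX.inner (hE.smooth i)) (hE.dirDeriv_mem_frame i g hg)
  have h4 : ∀ᶠ q in 𝓝 p, dirDeriv g q (X q)
      = ∑ i, inner ℝ (X q) (E i q) * dirDeriv g q (E i q) := by
    filter_upwards [hE.eventually] with q h1
    conv_lhs => rw [h1.expand (X q)]
    exact dirDeriv_vec_sum _ _ _ _
  filter_upwards [h, h4.eventually_nhds] with q h5 h6
  exact h5.congr_of_eventuallyEq h6

/-- The germ of `g([E i, E j], E k)`. -/
def IsFrameNear.structure_coeff (hE : IsFrameNear E p) (i j k : Fin n) : GermRing n p :=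
  toGerm (fun q => inner ℝ (VectorField.mlieBracket (𝓡 n) (E i) (E j) q) (E k q))
    (((hE.smooth i).mlieBracket (hE.smooth j)).inner (hE.smooth k))

lemma IsFrameNear.structure_coeff_swap (hE : IsFrameNear E p) (i j k : Fin n) :
    hE.structure_coeff i j k = -hE.structure_coeff j i k := by
  refine toGerm_eq.2 (Filter.Eventually.of_forall fun q => ?_)
  beta_reduce
  rw [VectorField.mlieBracket_swap_apply, inner_neg_left]
  rfl

/-- The frame calculus of the germs at `p`. -/
def IsFrameNear.calc (hE : IsFrameNear E p) : FrameCalculus (Fin n) (GermRing n p) where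
  D i := dirDerivation (E i) (hE.dirDeriv_mem_frame i)
  -- In the Koszul formula for an orthonormal frame the inner products are constant, so only the
  -- bracket terms survive.
  Γ i j k := algebraMap ℝ _ (1 / 2)
    * (hE.structure_coeff i j k - hE.structure_coeff i k j - hE.structure_coeff j k i)
  skew i j k := by rw [hE.structure_coeff_swap k j i]; ring

lemma IsFrameNear.torsion_free (hE : IsFrameNear E p) (i j k : Fin n) :
    hE.calc.Γ i j k - hE.calc.Γ j i k = hE.structure_coeff i j k := by
  have h : algebraMap ℝ (GermRing n p) (1 / 2) * 2 = 1 := by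
    rw [← map_ofNat (algebraMap ℝ (GermRing n p)) 2, ← map_mul]
    norm_num
  simp only [IsFrameNear.calc]
  rw [hE.structure_coeff_swap j i k]
  linear_combination hE.structure_coeff i j k * h

/-- The coefficients in the frame of a vector field which is smooth near `p`. -/
def IsFrameNear.coef (hE : IsFrameNear E p) (X : Field n M) (hX : SmoothFieldNear X p) :
    Fin n → GermRing n p :=
  fun i => toGerm (fun q => inner ℝ (X q) (E i q)) (hX.inner (hE.smooth i))

lemma IsFrameNear.coef_congr (hE : IsFrameNear E p) {X Y : Field n M} (h : X =ᶠ[𝓝 p] Y)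
    (hX : SmoothFieldNear X p) (hY : SmoothFieldNear Y p) : hE.coef X hX = hE.coef Y hY := by
  ext i
  refine toGerm_eq.2 ?_
  filter_upwards [h] with q hq
  rw [hq]

lemma IsFrameNear.coef_add (hE : IsFrameNear E p) {X Y : Field n M}
    (hX : SmoothFieldNear X p) (hY : SmoothFieldNear Y p) :
    hE.coef (X + Y) (hX.add hY) = hE.coef X hX + hE.coef Y hY := by
  ext i
  refine toGerm_eq.2 (Filter.Eventually.of_forall fun q => ?_)
  exact inner_add_left _ _ _

lemma IsFrameNear.coef_sub (hE : IsFrameNear E p) {X Y : Field n M}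
    (hX : SmoothFieldNear X p) (hY : SmoothFieldNear Y p) :
    hE.coef (X - Y) (hX.sub hY) = hE.coef X hX - hE.coef Y hY := by
  ext i
  refine toGerm_eq.2 (Filter.Eventually.of_forall fun q => ?_)
  exact inner_sub_left _ _ _

lemma IsFrameNear.coef_frame (hE : IsFrameNear E p) (i : Fin n) :
    hE.coef (E i) (hE.smooth i) = FrameCalculus.e i := by
  ext j
  have : (FrameCalculus.e i : Fin n → GermRing n p) j
      = toGerm (fun _ => if i = j then (1 : ℝ) else 0) (const_mem_smoothNear _) := by
    rw [toGerm_const]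
    by_cases h : i = j
    · simp [FrameCalculus.e, h]
    · simp [FrameCalculus.e, h, Ne.symm h]
  rw [this]
  refine toGerm_eq.2 ?_
  filter_upwards [hE.eventually] with q hq using hq.inner_self i j

lemma IsFrameNear.exists_coef (hE : IsFrameNear E p) (a : Fin n → GermRing n p) :
    ∃ X hX, hE.coef X hX = a := by
  choose g hg hga using fun i => exists_toGerm (a i)
  refine ⟨fun q => ∑ i, g i q • E i q,
    SmoothFieldNear.sum fun i => SmoothFieldNear.smul (hg i) (hE.smooth i), ?_⟩
  ext i
  rw [hga]
  refine toGerm_eq.2 ?_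
  filter_upwards [hE.eventually] with q hq
  simp [sum_inner, real_inner_smul_left, hq.inner_self]

lemma IsFrameNear.act_coef (hE : IsFrameNear E p) {X : Field n M} (hX : SmoothFieldNear X p)
    {g : M → ℝ} (hg : g ∈ smoothNear n p) :
    hE.calc.act (hE.coef X hX) (toGerm g hg)
      = toGerm (fun q => dirDeriv g q (X q)) (hE.dirDeriv_mem hX hg) := by
  simp only [FrameCalculus.act, IsFrameNear.calc, IsFrameNear.coef, dirDerivation_toGerm]
  rw [toGerm_sum_mul Finset.univ (fun i => hX.inner (hE.smooth i))
    fun i => hE.dirDeriv_mem_frame i g hg]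
  refine toGerm_eq.2 ?_
  filter_upwards [hE.eventually] with q h1
  conv_rhs => rw [h1.expand (X q)]
  exact (dirDeriv_vec_sum _ _ _ _).symm

lemma IsFrameNear.coef_dotProduct (hE : IsFrameNear E p) {X Y : Field n M}
    (hX : SmoothFieldNear X p) (hY : SmoothFieldNear Y p) :
    hE.coef X hX ⬝ᵥ hE.coef Y hY = toGerm (fun q => inner ℝ (X q) (Y q)) (hX.inner hY) := by
  simp only [dotProduct, IsFrameNear.coef]
  rw [toGerm_sum_mul Finset.univ (fun i => hX.inner (hE.smooth i))
    fun i => hY.inner (hE.smooth i)]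
  refine toGerm_eq.2 ?_
  filter_upwards [hE.eventually] with q h1
  exact (h1.inner_expand _ _).symm

lemma IsFrameNear.coef_mlieBracket_right (hE : IsFrameNear E p) {X Y : Field n M}
    (hX : SmoothFieldNear X p) (hY : SmoothFieldNear Y p) (k : Fin n) :
    hE.coef _ (hX.mlieBracket hY) k = hE.calc.act (hE.coef X hX) (hE.coef Y hY k)
      + ∑ j, hE.coef Y hY j * hE.coef _ (hX.mlieBracket (hE.smooth j)) k := by
  have h1 : hE.calc.act (hE.coef X hX) (hE.coef Y hY k) = _ :=
    hE.act_coef hX (hY.inner (hE.smooth k))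
  rw [h1]
  simp only [IsFrameNear.coef]
  rw [toGerm_sum_mul Finset.univ (fun j => hY.inner (hE.smooth j))
    fun j => (hX.mlieBracket (hE.smooth j)).inner (hE.smooth k), toGerm_add]
  refine toGerm_eq.2 ?_
  filter_upwards [hE.eventually, hY.eventually] with q h2 h3
  have h4 : Y =ᶠ[𝓝 q] (∑ j, (fun z => inner ℝ (Y z) (E j z)) • E j : Field n M) := by
    filter_upwards [h2.eventually] with z hz
    exact (hz.expand (Y z)).trans (Finset.sum_apply z Finset.univ
      (fun j => ((fun z => inner ℝ (Y z) (E j z)) • E j : Field n M))).symm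
  have h5 := mlieBracket_sum_smul (p := q) (X := X) Finset.univ h2.smooth
    (b := fun j z => inner ℝ (Y z) (E j z)) fun j => h3.inner (h2.smooth j)
  rw [Filter.EventuallyEq.mlieBracket_vectorField_eq (Filter.EventuallyEq.refl _ X) h4, h5,
    sum_inner]
  simp only [inner_add_left, real_inner_smul_left, Finset.sum_add_distrib, h2.inner_self]
  simp

lemma IsFrameNear.coef_mlieBracket (hE : IsFrameNear E p) {X Y : Field n M}
    (hX : SmoothFieldNear X p) (hY : SmoothFieldNear Y p) :
    hE.coef _ (hX.mlieBracket hY) = hE.calc.br (hE.coef X hX) (hE.coef Y hY) := by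
  ext k
  have hneg : ∀ {X Y : Field n M} (hX : SmoothFieldNear X p) (hY : SmoothFieldNear Y p) (k : Fin n),
      hE.coef _ (hX.mlieBracket hY) k = -hE.coef _ (hY.mlieBracket hX) k := fun {X Y} hX hY k => by
    refine toGerm_eq.2 (Filter.Eventually.of_forall fun q => ?_)
    beta_reduce
    rw [VectorField.mlieBracket_swap_apply, inner_neg_left]
    rfl
  have hs : ∀ i j k, hE.coef _ ((hE.smooth i).mlieBracket (hE.smooth j)) k
      = hE.calc.Γ i j k - hE.calc.Γ j i k := fun i j k => (hE.torsion_free i j k).symm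
  rw [hE.coef_mlieBracket_right hX hY]
  simp only [hneg hX (hE.smooth _), hE.coef_mlieBracket_right (hE.smooth _) hX, hs, hE.coef_frame,
    FrameCalculus.e_act, FrameCalculus.br, FrameCalculus.nab, Pi.sub_apply, mul_neg, mul_add,
    mul_sub, Finset.sum_neg_distrib, Finset.sum_add_distrib, Finset.sum_sub_distrib,
    Finset.mul_sum, neg_add, neg_sub]
  have h2 : hE.calc.act (hE.coef Y hY) (hE.coef X hX k)
      = ∑ j, hE.coef Y hY j * hE.calc.D j (hE.coef X hX k) := rfl
  have h3 : ∑ i, ∑ j, hE.coef X hX i * hE.coef Y hY j * hE.calc.Γ i j k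
      = ∑ j, ∑ i, hE.coef Y hY j * (hE.coef X hX i * hE.calc.Γ i j k) := by
    rw [Finset.sum_comm]
    exact Finset.sum_congr rfl fun i _ => Finset.sum_congr rfl fun j _ => by ring
  have h4 : ∑ i, ∑ j, hE.coef Y hY i * hE.coef X hX j * hE.calc.Γ i j k
      = ∑ j, ∑ i, hE.coef Y hY j * (hE.coef X hX i * hE.calc.Γ j i k) :=
    Finset.sum_congr rfl fun i _ => Finset.sum_congr rfl fun j _ => by ring
  rw [h2, h3, h4]
  ring

/-- The Jacobi identity for X, Y, g E_k is compared with g times the one for X, Y, E_k; the E_k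
component of the difference is the claim. The index k only supplies a nonvanishing field. -/
lemma IsFrameNear.dirDeriv_mlieBracket (hE : IsFrameNear E p) (k : Fin n) {X Y : Field n M}
    (hX : SmoothFieldNear X p) (hY : SmoothFieldNear Y p) {g : M → ℝ} (hg : g ∈ smoothNear n p) :
    dirDeriv g p (VectorField.mlieBracket (𝓡 n) X Y p)
      = dirDeriv (fun q => dirDeriv g q (Y q)) p (X p)
        - dirDeriv (fun q => dirDeriv g q (X q)) p (Y p) := by
  have hm : IsManifold (𝓡 n) (minSmoothness ℝ 3) M := by
    rw [minSmoothness_of_isRCLikeNormedField]; infer_instance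
  have two : ∀ {X : Field n M}, SmoothFieldNear X p → ContMDiffAt (𝓡 n) (𝓡 n).tangent
      (minSmoothness ℝ 2) (fun q => (⟨q, X q⟩ : TangentBundle (𝓡 n) M)) p := fun h => by
    rw [minSmoothness_of_isRCLikeNormedField]
    exact h.self_of_nhds.of_le (WithTop.coe_le_coe.2 (le_top : (2 : ℕ∞) ≤ ⊤))
  have hZ := hE.smooth k
  have key : ∀ {X Y : Field n M}, SmoothFieldNear X p → SmoothFieldNear Y p →
      VectorField.mlieBracket (𝓡 n) X (VectorField.mlieBracket (𝓡 n) Y (g • E k)) p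
        = dirDeriv (fun q => dirDeriv g q (Y q)) p (X p) • E k p
          + dirDeriv g p (Y p) • VectorField.mlieBracket (𝓡 n) X (E k) p
          + (dirDeriv g p (X p) • VectorField.mlieBracket (𝓡 n) Y (E k) p
          + g p • VectorField.mlieBracket (𝓡 n) X (VectorField.mlieBracket (𝓡 n) Y (E k)) p) := by
    intro X Y hX hY
    have h1 : VectorField.mlieBracket (𝓡 n) Y (g • E k) =ᶠ[𝓝 p]
        (fun q => dirDeriv g q (Y q)) • E k + g • VectorField.mlieBracket (𝓡 n) Y (E k) := by
      filter_upwards [eventually_eventually_nhds.2 hg, hZ.eventually] with q h1 h2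
      exact VectorField.mlieBracket_smul_right (mdifferentiableAt_of_mem h1) h2.mdifferentiableAt
    have hd := hE.dirDeriv_mem hY hg
    have hb := hY.mlieBracket hZ
    rw [Filter.EventuallyEq.mlieBracket_vectorField_eq (Filter.EventuallyEq.refl _ X) h1,
      VectorField.mlieBracket_add_right (SmoothFieldNear.smul hd hZ).mdifferentiableAt
        (SmoothFieldNear.smul hg hb).mdifferentiableAt,
      VectorField.mlieBracket_smul_right (mdifferentiableAt_of_mem hd) hZ.mdifferentiableAt,
      VectorField.mlieBracket_smul_right (mdifferentiableAt_of_mem hg) hb.mdifferentiableAt]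
    rfl
  have j1 := VectorField.leibniz_identity_mlieBracket_apply (two hX) (two hY)
    (two (SmoothFieldNear.smul hg hZ))
  have j2 := VectorField.leibniz_identity_mlieBracket_apply (two hX) (two hY) (two hZ)
  have h3 : VectorField.mlieBracket (𝓡 n) (VectorField.mlieBracket (𝓡 n) X Y) (g • E k) p
      = dirDeriv g p (VectorField.mlieBracket (𝓡 n) X Y p) • E k p
        + g p • VectorField.mlieBracket (𝓡 n) (VectorField.mlieBracket (𝓡 n) X Y) (E k) p :=
    VectorField.mlieBracket_smul_right (mdifferentiableAt_of_mem hg) hZ.mdifferentiableAt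
  rw [key hX hY, key hY hX, h3, j2] at j1
  have j3 := congrArg (fun v => inner ℝ v (E k p)) j1
  simp only [smul_add, inner_add_left, real_inner_smul_left, hE.inner_self, if_true, mul_one] at j3
  linarith

lemma IsFrameNear.isLie (hE : IsFrameNear E p) : hE.calc.IsLie where
  comm a b s := by
    obtain ⟨X, hX, rfl⟩ := hE.exists_coef a
    obtain ⟨Y, hY, rfl⟩ := hE.exists_coef b
    obtain ⟨g, hg, rfl⟩ := exists_toGerm s
    rcases isEmpty_or_nonempty (Fin n) with h | ⟨⟨k⟩⟩
    · simp [FrameCalculus.act]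
    rw [← hE.coef_mlieBracket hX hY, hE.act_coef, hE.act_coef, hE.act_coef, hE.act_coef,
      hE.act_coef, toGerm_sub, toGerm_eq]
    filter_upwards [hE.eventually, hX.eventually, hY.eventually, eventually_eventually_nhds.2 hg]
      with q h1 h2 h3 h4
    exact (h1.dirDeriv_mlieBracket k h2 h3 h4).symm
  jacobi a b c := by
    obtain ⟨X, hX, rfl⟩ := hE.exists_coef a
    obtain ⟨Y, hY, rfl⟩ := hE.exists_coef b
    obtain ⟨Z, hZ, rfl⟩ := hE.exists_coef c
    rw [← hE.coef_mlieBracket hY hZ, ← hE.coef_mlieBracket hX hY, ← hE.coef_mlieBracket hX hZ,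
      ← hE.coef_mlieBracket, ← hE.coef_mlieBracket, ← hE.coef_mlieBracket, ← hE.coef_add]
    apply hE.coef_congr
    have hm : IsManifold (𝓡 n) (minSmoothness ℝ 3) M := by
      rw [minSmoothness_of_isRCLikeNormedField]; infer_instance
    filter_upwards [hX, hY, hZ] with q h1 h2 h3
    have two : ∀ {X : Field n M}, ContMDiffAt (𝓡 n) (𝓡 n).tangent ∞
        (fun q => (⟨q, X q⟩ : TangentBundle (𝓡 n) M)) q → ContMDiffAt (𝓡 n) (𝓡 n).tangent
        (minSmoothness ℝ 2) (fun q => (⟨q, X q⟩ : TangentBundle (𝓡 n) M)) q := fun h => by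
      rw [minSmoothness_of_isRCLikeNormedField]
      exact h.of_le (WithTop.coe_le_coe.2 (le_top : (2 : ℕ∞) ≤ ⊤))
    exact VectorField.leibniz_identity_mlieBracket_apply (two h1) (two h2) (two h3)

end

/-! ### The Levi-Civita connection and curvature in a frame -/

lemma FrameCalculus.nab_apply {ι S : Type*} [Fintype ι] [DecidableEq ι] [CommRing S] [Algebra ℝ S]
    (F : FrameCalculus ι S) (a b : ι → S) (k : ι) :
    F.nab a b k = ∑ i, a i * F.nab (e i) b k := by
  have h : ∀ i, F.nab (e i) b k = F.D i (b k) + ∑ j, b j * F.Γ i j k := fun i => by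
    simp only [nab, e_act]; simp [e, Pi.single_apply]
  simp only [h]
  simp only [nab, act, mul_add, Finset.sum_add_distrib, Finset.mul_sum, mul_assoc]

section

variable {n : ℕ} {M : Type*} [TopologicalSpace M] [ChartedSpace (EuclideanSpace ℝ (Fin n)) M]
  {p : M} [IsManifold (𝓡 n) ∞ M]
  [RiemannianBundle (fun p : M => TangentSpace (𝓡 n) p)]
  [IsContMDiffRiemannianBundle (𝓡 n) ∞ (EuclideanSpace ℝ (Fin n))
      (fun p : M => TangentSpace (𝓡 n) p)]
  {E : Fin n → Field n M}

lemma mem_smoothNear_of_eventuallyEq {g g' : M → ℝ} (hg : g ∈ smoothNear n p) (h : g =ᶠ[𝓝 p] g') :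
    g' ∈ smoothNear n p := by
  filter_upwards [hg, h.eventually_nhds] with q h5 h6
  exact h5.congr_of_eventuallyEq (Filter.EventuallyEq.symm h6)

lemma IsFrameNear.koszul_mem (hE : IsFrameNear E p) {X Y Z : Field n M}
    (hX : SmoothFieldNear X p) (hY : SmoothFieldNear Y p) (hZ : SmoothFieldNear Z p) :
    koszul X Y Z ∈ smoothNear n p := by
  have h1 := hE.dirDeriv_mem hX (hY.inner hZ)
  have h2 := hE.dirDeriv_mem hY (hZ.inner hX)
  have h3 := hE.dirDeriv_mem hZ (hX.inner hY)
  have h4 := (hX.mlieBracket hY).inner hZ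
  have h5 := (hX.mlieBracket hZ).inner hY
  have h6 := (hY.mlieBracket hZ).inner hX
  have h := mul_mem (sub_mem (sub_mem (add_mem (sub_mem (add_mem h1 h2) h3) h4) h5) h6)
    (const_mem_smoothNear (n := n) (p := p) 2⁻¹)
  convert h using 1
  ext q
  exact div_eq_mul_inv _ _

lemma IsFrameNear.toGerm_koszul (hE : IsFrameNear E p) {X Y Z : Field n M}
    (hX : SmoothFieldNear X p) (hY : SmoothFieldNear Y p) (hZ : SmoothFieldNear Z p) :
    toGerm (koszul X Y Z) (hE.koszul_mem hX hY hZ)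
      = hE.calc.nab (hE.coef X hX) (hE.coef Y hY) ⬝ᵥ hE.coef Z hZ := by
  have h1 := hE.act_coef hX (hY.inner hZ)
  have h2 := hE.act_coef hY (hZ.inner hX)
  have h3 := hE.act_coef hZ (hX.inner hY)
  have h4 := hE.coef_dotProduct (hX.mlieBracket hY) hZ
  have h5 := hE.coef_dotProduct (hX.mlieBracket hZ) hY
  have h6 := hE.coef_dotProduct (hY.mlieBracket hZ) hX
  have h : toGerm (koszul X Y Z) (hE.koszul_mem hX hY hZ) + toGerm (koszul X Y Z)
      (hE.koszul_mem hX hY hZ) = toGerm _ (hE.dirDeriv_mem hX (hY.inner hZ))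
      + toGerm _ (hE.dirDeriv_mem hY (hZ.inner hX)) - toGerm _ (hE.dirDeriv_mem hZ (hX.inner hY))
      + toGerm _ ((hX.mlieBracket hY).inner hZ) - toGerm _ ((hX.mlieBracket hZ).inner hY)
      - toGerm _ ((hY.mlieBracket hZ).inner hX) := by
    refine toGerm_eq.2 (Filter.Eventually.of_forall fun q => ?_)
    exact add_halves _
  rw [← h1, ← h2, ← h3, ← h4, ← h5, ← h6, ← hE.coef_dotProduct hY hZ, ← hE.coef_dotProduct hZ hX,
    ← hE.coef_dotProduct hX hY, hE.coef_mlieBracket hX hY,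
    hE.coef_mlieBracket hX hZ, hE.coef_mlieBracket hY hZ] at h
  simp only [FrameCalculus.metric, FrameCalculus.br, sub_dotProduct] at h
  rw [dotProduct_comm (hE.coef Y hY), dotProduct_comm (hE.coef Z hZ),
    dotProduct_comm (hE.coef X hX)] at h
  have h2 : (2 : GermRing n p) * (toGerm (koszul X Y Z) (hE.koszul_mem hX hY hZ)
      - hE.calc.nab (hE.coef X hX) (hE.coef Y hY) ⬝ᵥ hE.coef Z hZ) = 0 := by
    linear_combination h
  exact sub_eq_zero.1 (eq_zero_of_mul_of_ev isUnit_of_germEval_ne_zero (by simp [map_ofNat]) h2)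

lemma IsFrameNear.koszul_eq (hE : IsFrameNear E p) {X Y Z : Field n M}
    (hX : SmoothFieldNear X p) (hY : SmoothFieldNear Y p) (hZ : SmoothFieldNear Z p) :
    koszul X Y Z p = ∑ i, ∑ k, inner ℝ (X p) (E i p)
      * germEval p (hE.calc.nab (FrameCalculus.e i) (hE.coef Y hY) k) * inner ℝ (Z p) (E k p) := by
  rw [← germEval_toGerm _ (hE.koszul_mem hX hY hZ), hE.toGerm_koszul hX hY hZ, dotProduct, map_sum,
    Finset.sum_comm]
  refine Finset.sum_congr rfl fun k _ => ?_
  rw [hE.calc.nab_apply, Finset.sum_mul, map_sum]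
  refine Finset.sum_congr rfl fun i _ => ?_
  rw [map_mul, map_mul]
  rfl

/-- `cov` is built from arbitrary extensions of vectors at p. By `koszul_eq` the Koszul expression
sees X and Z only through their values at p, so the extensions do not matter. -/
lemma IsFrameNear.inner_cov (hE : IsFrameNear E p) {X Y Z : Field n M}
    (hX : SmoothFieldNear X p) (hY : SmoothFieldNear Y p) (hZ : SmoothFieldNear Z p) :
    inner ℝ (cov Y p (X p)) (Z p) = koszul X Y Z p := by
  rw [hE.koszul_eq hX hY hZ]
  simp only [cov, sum_inner, real_inner_smul_left]
  have : ∀ l, koszul (RiemGeom.ext (X p)) Y (RiemGeom.ext (onb p l)) p = _ := fun l =>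
    hE.koszul_eq (.ext (X p)) hY (.ext (onb p l))
  simp only [this, ext_self, Finset.sum_mul]
  rw [Finset.sum_comm]
  refine Finset.sum_congr rfl fun i _ => ?_
  rw [Finset.sum_comm]
  refine Finset.sum_congr rfl fun k _ => ?_
  simp only [mul_assoc, ← Finset.mul_sum]
  congr 2
  rw [← (onb p).sum_inner_mul_inner (Z p) (E k p)]
  exact Finset.sum_congr rfl fun l _ => by rw [real_inner_comm (Z p), mul_comm]

lemma IsFrameNear.nabla_inner_frame (hE : IsFrameNear E p) {X Y : Field n M}
    (hX : SmoothFieldNear X p) (hY : SmoothFieldNear Y p) (k : Fin n) :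
    koszul X Y (E k) =ᶠ[𝓝 p] fun q => inner ℝ (nabla X Y q) (E k q) := by
  filter_upwards [hE.eventually, hX.eventually, hY.eventually] with q h1 h2 h3
  exact (h1.inner_cov h2 h3 (h1.smooth k)).symm

lemma IsFrameNear.nabla (hE : IsFrameNear E p) {X Y : Field n M}
    (hX : SmoothFieldNear X p) (hY : SmoothFieldNear Y p) : SmoothFieldNear (nabla X Y) p :=
  hE.smoothFieldNear fun k => mem_smoothNear_of_eventuallyEq
    (hE.koszul_mem hX hY (hE.smooth k)) (hE.nabla_inner_frame hX hY k)

lemma IsFrameNear.coef_nabla (hE : IsFrameNear E p) {X Y : Field n M}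
    (hX : SmoothFieldNear X p) (hY : SmoothFieldNear Y p) :
    hE.coef _ (hE.nabla hX hY) = hE.calc.nab (hE.coef X hX) (hE.coef Y hY) := by
  ext k
  have h := hE.toGerm_koszul hX hY (hE.smooth k)
  rw [hE.coef_frame, FrameCalculus.dotProduct_e] at h
  rw [← h]
  exact toGerm_eq.2 (hE.nabla_inner_frame hX hY k).symm

lemma IsFrameNear.curv (hE : IsFrameNear E p) {X Y Z : Field n M} (hX : SmoothFieldNear X p)
    (hY : SmoothFieldNear Y p) (hZ : SmoothFieldNear Z p) : SmoothFieldNear (curv X Y Z) p :=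
  ((hE.nabla hX (hE.nabla hY hZ)).sub (hE.nabla hY (hE.nabla hX hZ))).sub
    (hE.nabla (hX.mlieBracket hY) hZ)

lemma IsFrameNear.coef_curv (hE : IsFrameNear E p) {X Y Z : Field n M} (hX : SmoothFieldNear X p)
    (hY : SmoothFieldNear Y p) (hZ : SmoothFieldNear Z p) :
    hE.coef _ (hE.curv hX hY hZ)
      = hE.calc.Rm (hE.coef X hX) (hE.coef Y hY) (hE.coef Z hZ) := by
  rw [FrameCalculus.Rm, ← hE.coef_mlieBracket hX hY]
  simp only [← hE.coef_nabla, ← hE.coef_sub]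
  rfl

lemma IsFrameNear.covCurv (hE : IsFrameNear E p) {W X Y Z : Field n M} (hW : SmoothFieldNear W p)
    (hX : SmoothFieldNear X p) (hY : SmoothFieldNear Y p) (hZ : SmoothFieldNear Z p) :
    SmoothFieldNear (covCurv W X Y Z) p :=
  (((hE.nabla hW (hE.curv hX hY hZ)).sub (hE.curv (hE.nabla hW hX) hY hZ)).sub
    (hE.curv hX (hE.nabla hW hY) hZ)).sub (hE.curv hX hY (hE.nabla hW hZ))

lemma IsFrameNear.coef_covCurv (hE : IsFrameNear E p) {W X Y Z : Field n M}
    (hW : SmoothFieldNear W p)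
    (hX : SmoothFieldNear X p) (hY : SmoothFieldNear Y p) (hZ : SmoothFieldNear Z p) :
    hE.coef _ (hE.covCurv hW hX hY hZ)
      = hE.calc.covRm (hE.coef W hW) (hE.coef X hX) (hE.coef Y hY) (hE.coef Z hZ) := by
  simp only [FrameCalculus.covRm, ← hE.coef_nabla, ← hE.coef_curv, ← hE.coef_sub]
  rfl

/-! ### Ricci tensor, gradient and Hessian -/

lemma IsFrameNear.inner_curv (hE : IsFrameNear E p) {X Y Z : Field n M}
    (hX : SmoothFieldNear X p) (hY : SmoothFieldNear Y p) (hZ : SmoothFieldNear Z p)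
    (w : TangentSpace (𝓡 n) p) :
    inner ℝ (RiemGeom.curv X Y Z p) w = ∑ l, ∑ i, inner ℝ (X p) (E i p) * inner ℝ w (E l p)
      * ∑ j, ∑ k, inner ℝ (Y p) (E j p) * inner ℝ (Z p) (E k p)
        * germEval p (hE.calc.Rm (FrameCalculus.e i) (FrameCalculus.e j) (FrameCalculus.e k) l) := by
  rw [hE.inner_expand]
  refine Finset.sum_congr rfl fun l _ => ?_
  have h : inner ℝ (RiemGeom.curv X Y Z p) (E l p) = germEval p (hE.coef _ (hE.curv hX hY hZ) l) :=
    rfl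
  rw [h, hE.coef_curv hX hY hZ, hE.isLie.Rm_apply, map_sum, Finset.sum_mul]
  refine Finset.sum_congr rfl fun i _ => ?_
  rw [map_sum, Finset.sum_mul, Finset.mul_sum]
  refine Finset.sum_congr rfl fun j _ => ?_
  rw [map_sum, Finset.sum_mul, Finset.mul_sum]
  refine Finset.sum_congr rfl fun k _ => ?_
  simp only [map_mul, IsFrameNear.coef, germEval_toGerm]
  ring

lemma IsFrameNear.ricci_eq (hE : IsFrameNear E p) (v w : TangentSpace (𝓡 n) p) :
    ricci p v w = ∑ j, ∑ k, inner ℝ v (E j p) * inner ℝ w (E k p)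
      * germEval p (hE.calc.Ric (FrameCalculus.e j) (FrameCalculus.e k)) := by
  have h : ∀ m, inner ℝ (RiemGeom.curv (RiemGeom.ext (onb p m)) (RiemGeom.ext v) (RiemGeom.ext w) p)
      (onb p m) = _ := fun m => hE.inner_curv (.ext (onb p m)) (.ext v) (.ext w) (onb p m)
  simp only [ricci, h, ext_self]
  rw [Finset.sum_comm]
  have h2 : ∀ l i, ∑ m, inner ℝ (onb p m) (E i p) * inner ℝ (onb p m) (E l p)
      = if i = l then (1 : ℝ) else 0 := fun l i => by
    rw [← hE.inner_self, ← (onb p).sum_inner_mul_inner (E i p) (E l p)]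
    exact Finset.sum_congr rfl fun m _ => by rw [real_inner_comm (E i p)]
  have h3 : ∀ l, (∑ m, ∑ i, inner ℝ (onb p m) (E i p) * inner ℝ (onb p m) (E l p)
      * ∑ j, ∑ k, inner ℝ v (E j p) * inner ℝ w (E k p)
        * germEval p (hE.calc.Rm (FrameCalculus.e i) (FrameCalculus.e j) (FrameCalculus.e k) l))
      = ∑ j, ∑ k, inner ℝ v (E j p) * inner ℝ w (E k p)
        * germEval p (hE.calc.Rm (FrameCalculus.e l) (FrameCalculus.e j) (FrameCalculus.e k) l) := by
    intro l
    rw [Finset.sum_comm]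
    simp only [← Finset.sum_mul, h2]
    simp
  simp only [h3]
  rw [Finset.sum_comm]
  refine Finset.sum_congr rfl fun j _ => ?_
  rw [Finset.sum_comm]
  refine Finset.sum_congr rfl fun k _ => ?_
  rw [FrameCalculus.Ric, map_sum, Finset.mul_sum]

lemma IsFrameNear.ricci_frame (hE : IsFrameNear E p) (i j : Fin n) :
    ricci p (E i p) (E j p)
      = germEval p (hE.calc.Ric (FrameCalculus.e i) (FrameCalculus.e j)) := by
  rw [hE.ricci_eq]
  simp [hE.inner_self]

/-- `ricci` is defined with a separate basis and separate extensions at each point, so smoothness in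
q is not visible. It follows from agreement near p with the trace K of the curvature over the smooth
frame. -/
lemma IsFrameNear.Ric_eq (hE : IsFrameNear E p) (i j : Fin n) :
    ∃ h, hE.calc.Ric (FrameCalculus.e i) (FrameCalculus.e j)
      = toGerm (fun q => ricci q (E i q) (E j q)) h := by
  obtain ⟨K, hK⟩ : ∃ K : M → ℝ, K = fun q => ∑ k, inner ℝ (RiemGeom.curv (E k) (E i) (E j) q) (E k q) :=
    ⟨_, rfl⟩
  have hmem : ∀ {q} (h : IsFrameNear E q), K ∈ smoothNear n q := fun {q} h => by
    rw [hK]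
    exact sum_mem_smoothNear _ fun k => (h.curv (h.smooth k) (h.smooth i) (h.smooth j)).inner
      (h.smooth k)
  have hRic : ∀ {q} (h : IsFrameNear E q),
      h.calc.Ric (FrameCalculus.e i) (FrameCalculus.e j) = toGerm K (hmem h) := fun {q} h => by
    subst hK
    rw [FrameCalculus.Ric, ← toGerm_sum Finset.univ fun k =>
      (h.curv (h.smooth k) (h.smooth i) (h.smooth j)).inner (h.smooth k)]
    refine Finset.sum_congr rfl fun k _ => ?_
    rw [← h.coef_frame i, ← h.coef_frame j, ← h.coef_frame k, ← h.coef_curv]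
    rfl
  have heq : K =ᶠ[𝓝 p] fun q => ricci q (E i q) (E j q) := by
    filter_upwards [hE.eventually] with q h
    rw [h.ricci_frame, hRic h, germEval_toGerm]
  exact ⟨mem_smoothNear_of_eventuallyEq (hmem hE) heq, (hRic hE).trans (toGerm_eq.2 heq)⟩

lemma IsFrameNear.scal_eq (hE : IsFrameNear E p) : scal n p = ∑ i, ricci p (E i p) (E i p) := by
  simp only [scal, hE.ricci_frame]
  simp only [hE.ricci_eq]
  rw [Finset.sum_comm]
  refine Finset.sum_congr rfl fun j _ => ?_
  rw [Finset.sum_comm]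
  have h2 : ∀ k, ∑ m, inner ℝ (onb p m) (E j p) * inner ℝ (onb p m) (E k p)
      = if j = k then (1 : ℝ) else 0 := fun k => by
    rw [← hE.inner_self, ← (onb p).sum_inner_mul_inner (E j p) (E k p)]
    exact Finset.sum_congr rfl fun m _ => by rw [real_inner_comm (E j p)]
  simp only [← Finset.sum_mul, h2]
  simp

lemma inner_grad (f : M → ℝ) (v : TangentSpace (𝓡 n) p) :
    inner ℝ (grad n f p) v = dirDeriv f p v := by
  conv_rhs => rw [← (onb p).sum_repr' v, dirDeriv_vec_sum]
  simp only [grad, sum_inner, real_inner_smul_left]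
  exact Finset.sum_congr rfl fun i _ => mul_comm _ _

lemma IsFrameNear.grad (hE : IsFrameNear E p) {f : M → ℝ} (hf : f ∈ smoothNear n p) :
    SmoothFieldNear (grad n f) p :=
  hE.smoothFieldNear fun k => by
    simp only [inner_grad]
    exact hE.dirDeriv_mem_frame k f hf

lemma IsFrameNear.D_toGerm (hE : IsFrameNear E p) {f : M → ℝ} (hf : f ∈ smoothNear n p)
    (i : Fin n) : hE.calc.D i (toGerm f hf)
      = toGerm (fun q => dirDeriv f q (E i q)) (hE.dirDeriv_mem_frame i f hf) :=
  dirDerivation_toGerm _ _ _ _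

lemma IsFrameNear.coef_grad (hE : IsFrameNear E p) {f : M → ℝ} (hf : f ∈ smoothNear n p) :
    hE.coef _ (hE.grad hf) = fun i => hE.calc.D i (toGerm f hf) := by
  ext i
  rw [hE.D_toGerm]
  exact toGerm_eq.2 (Filter.Eventually.of_forall fun q => inner_grad _ _)

lemma IsFrameNear.nab_grad (hE : IsFrameNear E p) {f : M → ℝ} (hf : f ∈ smoothNear n p)
    (i k : Fin n) : ∃ h, hE.calc.nab (FrameCalculus.e i) (fun i => hE.calc.D i (toGerm f hf)) k
      = toGerm (fun q => hess f q (E i q) (E k q)) h := by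
  rw [← hE.coef_grad hf, ← hE.coef_frame i, ← hE.coef_nabla]
  exact ⟨_, rfl⟩

end

/-! ### Local constancy and coincidences of Ricci eigenvalues -/

section

variable {n : ℕ} {M : Type*} [TopologicalSpace M] [ChartedSpace (EuclideanSpace ℝ (Fin n)) M]
  {p : M} [IsManifold (𝓡 n) ∞ M]

/-- A function with vanishing derivative near `p` is constant near `p`. -/
lemma eventually_const_of_mvfderiv_eq_zero {g : M → ℝ} (hg : g ∈ smoothNear n p)
    (h : ∀ᶠ q in 𝓝 p, mvfderiv (𝓡 n) g q = 0) : ∀ᶠ q in 𝓝 p, g q = g p := by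
  have hm : IsManifold (𝓡 n) 1 M := .of_le (n := ∞) (by simp)
  set φ := extChartAt (𝓡 n) p with hφ
  have hc : ContinuousAt φ.symm (φ p) := continuousAt_extChartAt_symm p
  have hp : φ.symm (φ p) = p := extChartAt_to_inv p
  have h1 : ∀ᶠ z in 𝓝 (φ p), HasFDerivAt (g ∘ φ.symm) (0 : EuclideanSpace ℝ (Fin n) →L[ℝ] ℝ) z := by
    have h2 := hc.eventually (p := fun q => MDifferentiableAt (𝓡 n) 𝓘(ℝ, ℝ) g q
      ∧ mvfderiv (𝓡 n) g q = 0) (by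
        rw [hp]
        filter_upwards [eventually_eventually_nhds.2 hg, h] with q h3 h4
        exact ⟨mdifferentiableAt_of_mem h3, h4⟩)
    filter_upwards [h2, extChartAt_target_mem_nhds (I := 𝓡 n) p] with z ⟨h3, h4⟩ hz
    have h5 : HasMFDerivAt (𝓡 n) 𝓘(ℝ, ℝ) g (φ.symm z) 0 := by
      convert h3.hasMFDerivAt using 1
      exact h4.symm
    have h6 : MDifferentiableAt 𝓘(ℝ, EuclideanSpace ℝ (Fin n)) (𝓡 n) φ.symm z := by
      have := mdifferentiableWithinAt_extChartAt_symm (I := 𝓡 n) (x := p) hz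
      rwa [ModelWithCorners.range_eq_univ, mdifferentiableWithinAt_univ] at this
    have h7 := h5.comp z h6.hasMFDerivAt
    rw [hasMFDerivAt_iff_hasFDerivAt] at h7
    exact h7.congr_fderiv (ContinuousLinearMap.zero_comp _)
  obtain ⟨r, hr, hb⟩ := Metric.eventually_nhds_iff_ball.1 h1
  have h2 : ∀ᶠ q in 𝓝 p, φ q ∈ Metric.ball (φ p) r :=
    (continuousAt_extChartAt (I := 𝓡 n) p).eventually_mem (Metric.ball_mem_nhds _ hr)
  filter_upwards [h2, extChartAt_source_mem_nhds (I := 𝓡 n) p] with q h3 h4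
  have h5 := Metric.isOpen_ball.is_const_of_fderiv_eq_zero (𝕜 := ℝ)
    (convex_ball (φ p) r).isPreconnected
    (fun z hz => (hb z hz).differentiableAt.differentiableWithinAt)
    (fun z hz => (hb z hz).fderiv) h3 (Metric.mem_ball_self hr)
  rw [Function.comp_apply, Function.comp_apply, hp, φ.left_inv h4] at h5
  exact h5

variable [RiemannianBundle (fun p : M => TangentSpace (𝓡 n) p)]
  {E : Fin n → Field n M}

lemma IsOrthonormalFrameOn.isFrameNear {U : Set M} (hE : IsOrthonormalFrameOn E U)
    (hU : IsOpen U) (hp : p ∈ U) : IsFrameNear E p where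
  smooth i := by
    filter_upwards [hU.mem_nhds hp] with q hq using (hE.smooth i).contMDiffAt (hU.mem_nhds hq)
  orthonormal := by
    filter_upwards [hU.mem_nhds hp] with q hq using hE.orthonormal q hq

variable [IsContMDiffRiemannianBundle (𝓡 n) ∞ (EuclideanSpace ℝ (Fin n))
      (fun p : M => TangentSpace (𝓡 n) p)]

lemma IsFrameNear.eventually_const (hE : IsFrameNear E p) {g : M → ℝ} (hg : g ∈ smoothNear n p)
    (h : ∀ i, hE.calc.D i (toGerm g hg) = 0) : ∀ᶠ q in 𝓝 p, g q = g p := by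
  refine eventually_const_of_mvfderiv_eq_zero hg ?_
  have h1 : ∀ i, ∀ᶠ q in 𝓝 p, dirDeriv g q (E i q) = 0 := fun i => by
    have h2 := h i
    rw [hE.D_toGerm, show (0 : GermRing n p) = toGerm (fun _ => 0) (const_mem_smoothNear 0) from rfl,
      toGerm_eq] at h2
    exact h2
  filter_upwards [hE.eventually, Filter.eventually_all.2 h1] with q h2 h3
  ext v
  have h4 := dirDeriv_vec_sum Finset.univ g (fun i => inner ℝ v (E i q)) (fun i => E i q)
  rw [← h2.expand v] at h4
  simp only [h3, mul_zero, Finset.sum_const_zero] at h4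
  exact h4

lemma IsFrameNear.scal_mem (hE : IsFrameNear E p) : scal n ∈ smoothNear n p := by
  refine mem_smoothNear_of_eventuallyEq
    (sum_mem_smoothNear Finset.univ fun i => (hE.Ric_eq i i).choose) ?_
  filter_upwards [hE.eventually] with q hq using hq.scal_eq.symm

lemma IsFrameNear.toGerm_scal (hE : IsFrameNear E p) :
    toGerm (scal n) hE.scal_mem
      = ∑ i, hE.calc.Ric (FrameCalculus.e i) (FrameCalculus.e i) := by
  choose hmem hRic using fun i => hE.Ric_eq i i
  simp only [hRic]
  rw [toGerm_sum Finset.univ hmem, toGerm_eq]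
  filter_upwards [hE.eventually] with q hq using hq.scal_eq

lemma HasHarmonicCurvature.div_covRm (hharm : HasHarmonicCurvature n M) {U : Set M}
    (hU : IsOpen U) (hEU : IsOrthonormalFrameOn E U) (hp : p ∈ U) (hE : IsFrameNear E p)
    (j k l : Fin n) : ∑ i, hE.calc.covRm (FrameCalculus.e i) (FrameCalculus.e j)
      (FrameCalculus.e k) (FrameCalculus.e l) i = 0 := by
  have h : ∀ i, (fun q => inner ℝ (covCurv (E i) (E j) (E k) (E l) q) (E i q))
      ∈ smoothNear n p := fun i =>
    (hE.covCurv (hE.smooth i) (hE.smooth j) (hE.smooth k) (hE.smooth l)).inner (hE.smooth i)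
  have h2 : ∀ i, hE.calc.covRm (FrameCalculus.e i) (FrameCalculus.e j)
      (FrameCalculus.e k) (FrameCalculus.e l) i = toGerm _ (h i) := fun i => by
    simp only [← hE.coef_frame, ← hE.coef_covCurv]
    rfl
  simp only [h2]
  rw [toGerm_sum Finset.univ h,
    show (0 : GermRing n p) = toGerm (fun _ => 0) (const_mem_smoothNear 0) from rfl, toGerm_eq]
  filter_upwards [hU.mem_nhds hp] with q hq
  exact hharm U hU E hEU _ _ _ (hEU.smooth j) (hEU.smooth k) (hEU.smooth l) q hq

/-- For a frame of Ricci eigenvectors the Ricci eigenvalues are the ones of its members. -/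
lemma IsFrameNear.ricciEigenvalueCount_eq (hE : IsFrameNear E p) {a : Fin n → ℝ}
    (ha : ∀ i, ∀ w : TangentSpace (𝓡 n) p, ricci p (E i p) w = a i * inner ℝ (E i p) w) :
    ricciEigenvalueCount n p = (Set.range a).ncard := by
  rw [ricciEigenvalueCount]
  congr 1
  ext l
  constructor
  · rintro ⟨v, hv, h⟩
    have h1 : ∀ i, ricci p v (E i p) = a i * inner ℝ v (E i p) := fun i => by
      rw [hE.ricci_eq]
      simp only [← hE.ricci_frame, ha, hE.inner_self]
      simp [mul_comm]
    by_contra hl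
    apply hv
    rw [hE.expand v]
    refine Finset.sum_eq_zero fun i _ => ?_
    have h2 := (h (E i p)).symm.trans (h1 i)
    have h3 : (l - a i) * inner ℝ v (E i p) = 0 := by linarith
    rcases mul_eq_zero.1 h3 with h4 | h4
    · exact absurd ⟨i, (sub_eq_zero.1 h4).symm⟩ hl
    · rw [h4, zero_smul]
  · rintro ⟨i, rfl⟩
    refine ⟨E i p, fun h0 => ?_, ha i⟩
    have := hE.inner_self i i
    simp [h0] at this

/-- If `a` factors through `b` and both take equally many values then `b` factors through `a`. -/
lemma eq_of_ncard_range_eq {κ : Type*} [Finite κ] {a b : κ → ℝ}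
    (hab : ∀ i j, b i = b j → a i = a j) (h : (Set.range a).ncard = (Set.range b).ncard)
    {i j : κ} (hij : a i = a j) : b i = b j := by
  obtain ⟨g, rfl⟩ := (Function.factorsThrough_iff (f := b) a).1 fun i j => hab i j
  rw [Set.range_comp] at h
  exact Set.injOn_of_ncard_image_eq h (Set.finite_range b) ⟨i, rfl⟩ ⟨j, rfl⟩ hij

/-- Eigenvalues distinct at p stay distinct nearby by continuity. If some equal at p separated
nearby, the number of eigenvalues would increase, against regularity of p. -/
lemma IsAdaptedFrameOn.eventually_eq_iff [NeZero n] {f : M → ℝ} {lam : Fin n → M → ℝ} {U : Set M}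
    (hE : IsAdaptedFrameOn f E lam U) (hU : IsOpen U) (hp : p ∈ U)
    (hreg : p ∈ ricciRegularSet n M) (i j : Fin n) :
    ∀ᶠ q in 𝓝 p, (lam i q = lam j q ↔ lam i p = lam j p) := by
  have hF := hE.toIsOrthonormalFrameOn.isFrameNear hU hp
  have hlam : ∀ i, ∀ q ∈ U, ricci q (E i q) (E i q) = lam i q := fun i q hq => by
    rw [hE.eigen q hq, (hE.toIsOrthonormalFrameOn.isFrameNear hU hq).inner_self]
    simp
  have hc : ∀ i, ContinuousAt (lam i) p := fun i => by
    obtain ⟨h, -⟩ := hF.Ric_eq i i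
    refine h.self_of_nhds.continuousAt.congr ?_
    filter_upwards [hU.mem_nhds hp] with q hq using hlam i q hq
  have hne : ∀ᶠ q in 𝓝 p, ∀ i j, lam i q = lam j q → lam i p = lam j p := by
    refine Filter.eventually_all.2 fun i => Filter.eventually_all.2 fun j => ?_
    by_cases h : lam i p = lam j p
    · exact Filter.Eventually.of_forall fun q _ => h
    · filter_upwards [((hc i).ne_iff_eventually_ne (hc j)).1 h] with q hq h2 using absurd h2 hq
  filter_upwards [hne, hreg, hU.mem_nhds hp] with q h1 h2 h3
  rw [(hE.toIsOrthonormalFrameOn.isFrameNear hU h3).ricciEigenvalueCount_eq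
    (a := fun i => lam i q) (hE.eigen q h3), hF.ricciEigenvalueCount_eq
    (a := fun i => lam i p) (hE.eigen p hp)] at h2
  exact ⟨h1 i j, fun h => eq_of_ncard_range_eq (a := fun i => lam i p) (b := fun i => lam i q)
    h1 h2.symm h⟩

lemma IsAdaptedFrameOn.eq_iff [NeZero n] {f : M → ℝ} {lam : Fin n → M → ℝ} {U : Set M}
    (hE : IsAdaptedFrameOn f E lam U) (hU : IsOpen U) (hreg : U ⊆ ricciRegularSet n M)
    (hconn : IsPreconnected U) {p q : M} (hp : p ∈ U) (hq : q ∈ U) (i j : Fin n) :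
    lam i p = lam j p ↔ lam i q = lam j q := by
  have h : ContinuousOn (fun q => decide (lam i q = lam j q)) U := fun z hz => by
    refine ContinuousAt.continuousWithinAt ?_
    refine (continuousAt_const (y := decide (lam i z = lam j z))).congr ?_
    filter_upwards [hE.eventually_eq_iff hU hz (hreg hz) i j] with w hw
    simp [hw]
  simpa using hconn.constant h hp hq

end

/-! ### The contradiction at a point and the theorem -/

section

variable {M : Type*} [TopologicalSpace M] [ChartedSpace (EuclideanSpace ℝ (Fin 4)) M]
  [IsManifold (𝓡 4) ∞ M] [RiemannianBundle (fun p : M => TangentSpace (𝓡 4) p)]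
  [IsContMDiffRiemannianBundle (𝓡 4) ∞ (EuclideanSpace ℝ (Fin 4))
      (fun p : M => TangentSpace (𝓡 4) p)]

theorem IsAdaptedFrameOn.not_pairwise_ne (hharm : HasHarmonicCurvature 4 M)
    {f : M → ℝ} (hf : ContMDiff (𝓡 4) 𝓘(ℝ, ℝ) ∞ f) {x : ℝ} {y : ℝ → ℝ}
    (heq : ∀ (p : M) (v w : TangentSpace (𝓡 4) p),
      hess f p v w = f p * (ricci p v w - scal 4 p / 3 * inner ℝ v w)
          + x * ricci p v w + y (scal 4 p) * inner ℝ v w)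
    {U : Set M} (hU : IsOpen U) {E : Fin 4 → Field 4 M} {lam : Fin 4 → M → ℝ}
    (hE : IsAdaptedFrameOn f E lam U) {p : M} (hp : p ∈ U) (hgrad : grad 4 f p ≠ 0)
    (h12 : lam 1 p ≠ lam 2 p) (h13 : lam 1 p ≠ lam 3 p) (h23 : lam 2 p ≠ lam 3 p) : False := by
  have hF := hE.toIsOrthonormalFrameOn.isFrameNear hU hp
  have hfs : f ∈ smoothNear 4 p := Filter.Eventually.of_forall fun q => hf.contMDiffAt
  have hzero : (0 : GermRing 4 p) = toGerm (fun _ => 0) (const_mem_smoothNear 0) := rfl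
  choose hmem hRic using hF.Ric_eq
  -- `lam` is not assumed smooth, so the eigenvalue germs are taken from the diagonal Ricci entries.
  obtain ⟨l, hl⟩ : ∃ l : Fin 4 → GermRing 4 p,
      l = fun i => hF.calc.Ric (FrameCalculus.e i) (FrameCalculus.e i) := ⟨_, rfl⟩
  have hlam : ∀ i j, hF.calc.Ric (FrameCalculus.e i) (FrameCalculus.e j)
      = if i = j then l i else 0 := fun i j => by
    split_ifs with h
    · rw [hl, h]
    · rw [hRic, hzero, toGerm_eq]
      filter_upwards [hU.mem_nhds hp, hF.eventually] with q hq h2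
      rw [hE.eigen q hq, h2.inner_self, if_neg h, mul_zero]
  have hev : ∀ i, germEval p (l i) = lam i p := fun i => by
    rw [hl]
    beta_reduce
    rw [hRic, germEval_toGerm, hE.eigen p hp, hF.inner_self, if_pos rfl, mul_one]
  have hdiv := hharm.div_covRm hU hE.toIsOrthonormalFrameOn hp hF
  obtain ⟨R, hR⟩ : ∃ R, R = toGerm (scal 4) hF.scal_mem := ⟨_, rfl⟩
  have hRl : R = ∑ i, l i := by rw [hR, hF.toGerm_scal, hl]
  have hDR : ∀ i, hF.calc.D i R = 0 := fun i => by
    rw [hRl]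
    exact FrameCalculus.D_scal l hF.isLie hlam hdiv i
  -- The function y is arbitrary; it is the local constancy of the scalar curvature that makes y(R)
  -- a constant germ.
  have hconst : ∀ᶠ q in 𝓝 p, scal 4 q = scal 4 p :=
    hF.eventually_const hF.scal_mem fun i => hR ▸ hDR i
  have hDf : ∀ i, i ≠ 0 → hF.calc.D i (toGerm f hfs) = 0 := fun i hi => by
    rw [hF.D_toGerm, hzero, toGerm_eq]
    filter_upwards [hU.mem_nhds hp] with q hq using hE.tangent q hq i hi
  have hN : germEval p (hF.calc.D 0 (toGerm f hfs)) ≠ 0 := by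
    rw [hF.D_toGerm, germEval_toGerm, ← inner_grad, hE.first p hp, real_inner_smul_right,
      real_inner_self_eq_norm_sq]
    have := norm_ne_zero_iff.2 hgrad
    positivity
  have hthird : (3 : GermRing 4 p) * algebraMap ℝ (GermRing 4 p) (1 / 3) = 1 := by
    rw [← map_ofNat (algebraMap ℝ (GermRing 4 p)) 3, ← map_mul]
    norm_num
  have hDφ : ∀ i, hF.calc.D i (toGerm f hfs + algebraMap ℝ (GermRing 4 p) x)
      = hF.calc.D i (toGerm f hfs) := fun i => by
    rw [map_add, Derivation.map_algebraMap, add_zero]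
  have hgr : hF.calc.D 0 (toGerm f hfs) • (FrameCalculus.e 0 : Fin 4 → GermRing 4 p)
      = fun i => hF.calc.D i (toGerm f hfs) := by
    ext i
    by_cases h : i = 0
    · simp [FrameCalculus.e, h]
    · simp [FrameCalculus.e, h, hDf i h]
  refine hF.isLie.not_distinct isUnit_of_germEval_ne_zero l hlam hdiv
    (toGerm f hfs + algebraMap ℝ _ x) (hF.calc.D 0 (toGerm f hfs))
    (algebraMap ℝ _ (y (scal 4 p)) - algebraMap ℝ _ (1 / 3) * (toGerm f hfs * R))
    (fun i => ?_) hN (fun i => ?_) (fun i k => ?_)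
    (by rwa [hev, hev]) (by rwa [hev, hev]) (by rwa [hev, hev])
  · rw [hDφ]
    split_ifs with h
    · rw [h]
    · exact hDf i h
  · rw [hDφ, map_sub, Derivation.map_algebraMap, Derivation.leibniz, Derivation.map_algebraMap,
      Derivation.leibniz, hDR, ← hRl]
    simp only [smul_eq_mul]
    linear_combination (-hF.calc.D i (toGerm f hfs) * R) * hthird
  · rw [hgr]
    obtain ⟨hm, hn⟩ := hF.nab_grad hfs i k
    have hδ : toGerm (fun q => hess f q (E i q) (E k q)) hm
        = toGerm f hfs * (hF.calc.Ric (FrameCalculus.e i) (FrameCalculus.e k)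
          - algebraMap ℝ _ (1 / 3) * (R * algebraMap ℝ _ (if i = k then 1 else 0)))
          + algebraMap ℝ _ x * hF.calc.Ric (FrameCalculus.e i) (FrameCalculus.e k)
          + algebraMap ℝ _ (y (scal 4 p)) * algebraMap ℝ _ (if i = k then 1 else 0) := by
      simp only [hRic, hR, ← toGerm_const, toGerm_mul, toGerm_sub, toGerm_add]
      rw [toGerm_eq]
      filter_upwards [hconst, hF.eventually] with q h1 h2
      rw [heq, h1, h2.inner_self]
      ring
    rw [hn, hδ, hlam]
    split_ifs with h
    · rw [map_one]; ring
    · rw [map_zero]; ring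

end

end RiemGeom

end

theorem mainTheorem2 {M : Type*} [TopologicalSpace M] [T2Space M] [SecondCountableTopology M]
    [ChartedSpace (EuclideanSpace ℝ (Fin 4)) M] [IsManifold (𝓡 4) ∞ M]
    [RiemannianBundle (fun p : M => TangentSpace (𝓡 4) p)]
    [IsContMDiffRiemannianBundle (𝓡 4) ∞ (EuclideanSpace ℝ (Fin 4))
      (fun p : M => TangentSpace (𝓡 4) p)]
    (hharm : RiemGeom.HasHarmonicCurvature 4 M)
    (f : M → ℝ) (hf : ContMDiff (𝓡 4) 𝓘(ℝ, ℝ) ∞ f) (hfnc : ∃ a b : M, f a ≠ f b)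
    (x : ℝ) (y : ℝ → ℝ)
    (heq : ∀ (p : M) (v w : TangentSpace (𝓡 4) p),
      RiemGeom.hess f p v w =
        f p * (RiemGeom.ricci p v w - RiemGeom.scal 4 p / 3 * inner ℝ v w)
          + x * RiemGeom.ricci p v w + y (RiemGeom.scal 4 p) * inner ℝ v w)
    (U : Set M) (hU : IsOpen U)
    (hUsub : U ⊆ RiemGeom.ricciRegularSet 4 M ∩ {p : M | RiemGeom.grad 4 f p ≠ 0})
    (E : Fin 4 → RiemGeom.Field 4 M) (lam : Fin 4 → M → ℝ)
    (hE : RiemGeom.IsAdaptedFrameOn f E lam U) :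
    (∀ p ∈ U, lam 1 p = lam 2 p ∨ lam 1 p = lam 3 p ∨ lam 2 p = lam 3 p) ∧
      (IsPreconnected U →
        (∀ p ∈ U, lam 1 p = lam 2 p) ∨ (∀ p ∈ U, lam 1 p = lam 3 p) ∨
          (∀ p ∈ U, lam 2 p = lam 3 p)) := by
  have h : ∀ p ∈ U, lam 1 p = lam 2 p ∨ lam 1 p = lam 3 p ∨ lam 2 p = lam 3 p := by
    intro p hp
    by_contra! hne
    exact hE.not_pairwise_ne hharm hf heq hU hp (hUsub hp).2 hne.1 hne.2.1 hne.2.2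
  refine ⟨h, fun hconn => ?_⟩
  rcases U.eq_empty_or_nonempty with rfl | ⟨p, hp⟩
  · exact Or.inl fun p hp => hp.elim
  have hiff := fun q (hq : q ∈ U) => hE.eq_iff hU (fun z hz => (hUsub hz).1) hconn hp hq
  rcases h p hp with h1 | h1 | h1
  · exact Or.inl fun q hq => (hiff q hq 1 2).1 h1
  · exact Or.inr (Or.inl fun q hq => (hiff q hq 1 3).1 h1)
  · exact Or.inr (Or.inr fun q hq => (hiff q hq 2 3).1 h1)
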